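/- Let $G$ be a finite simple graph with at least one vertex and maximum degree $\Delta=\Delta(G)$. Suppose that $G$ is chordal (it has no induced cycle of length at least $4$) and outerplanar (it can be drawn in the plane without crossings, with edges drawn as straight segments, so that every vertex lies on the boundary of the unbounded face; by the Fáry theorem and its outerplanar version, allowing curved edges gives the same class of graphs). Let $G^2$ be the graph on $V(G)$ in which two distinct vertices are adjacent if and only if they are adjacent or have a common neighbour in $G$; let $\omega$ denote the clique number and $\chi$ the chromatic number. Let $F_4$ be the graph on six vertices obtained from a triangle by adding, for each of its three edges, a new vertex adjacent to exactly the two ends of that edge. Then $$\omega(G^2)=\chi(G^2)=\begin{cases}\Delta+2 & \text{if } \Delta=4 \text{ and } G \text{ contains } F_4 \text{ as a subgraph},\\ \Delta+1 & \text{in all other cases.}\end{cases}$$ -/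

import Mathlib

namespace ChordalOuterplanar

/-- The square of `G`: distinct vertices are adjacent when they are adjacent in `G` or have a
common neighbour in `G`. -/
def square {V : Type*} (G : SimpleGraph V) : SimpleGraph V where
  Adj u v := u ≠ v ∧ (G.Adj u v ∨ ∃ w, G.Adj u w ∧ G.Adj v w)
  symm := ⟨by
    rintro u v ⟨hne, h | ⟨w, hu, hv⟩⟩
    · exact ⟨hne.symm, Or.inl h.symm⟩
    · exact ⟨hne.symm, Or.inr ⟨w, hv, hu⟩⟩⟩
  loopless := ⟨fun _ h => h.1 rfl⟩

/-- A graph is chordal if it has no induced cycle of length at least four. -/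
def IsChordal {V : Type*} (G : SimpleGraph V) : Prop :=
  ∀ n : ℕ, 4 ≤ n → ¬ (SimpleGraph.cycleGraph n).IsIndContained G

/-- The Euclidean plane. -/
abbrev Plane : Type := EuclideanSpace ℝ (Fin 2)

/-- `p` places the vertices of `G` in the plane so that drawing each edge `uv` as the segment
from `p u` to `p v` gives a plane embedding: vertices are distinct points, no vertex lies on an
edge of which it is not an end, and two distinct edges have no common interior point. -/
structure IsPlaneDrawing {V : Type*} (G : SimpleGraph V) (p : V → Plane) : Prop where
  injective : Function.Injective p
  vertex_notMem_edge : ∀ u v w : V, G.Adj u v → w ≠ u → w ≠ v → p w ∉ segment ℝ (p u) (p v)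
  edges_disjoint : ∀ a b c d : V, G.Adj a b → G.Adj c d → s(a, b) ≠ s(c, d) →
    Disjoint (openSegment ℝ (p a) (p b)) (openSegment ℝ (p c) (p d))

/-- The set of points of the plane covered by the drawing (vertices and edges). -/
def drawing {V : Type*} (G : SimpleGraph V) (p : V → Plane) : Set Plane :=
  Set.range p ∪ {x | ∃ u v : V, G.Adj u v ∧ x ∈ segment ℝ (p u) (p v)}

/-- `F` is a face of the drawing: a connected component of the complement of the drawing. -/
def IsFace {V : Type*} (G : SimpleGraph V) (p : V → Plane) (F : Set Plane) : Prop :=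
  ∃ x ∈ (drawing G p)ᶜ, F = connectedComponentIn (drawing G p)ᶜ x

/-- A (finite, simple) graph is outerplanar if it has a plane embedding in which every vertex
lies on the boundary of the infinite face. The edges are drawn as straight segments. -/
def IsOuterplanar {V : Type*} (G : SimpleGraph V) : Prop :=
  ∃ p : V → Plane, IsPlaneDrawing G p ∧
    ∃ F : Set Plane, IsFace G p F ∧ ¬ Bornology.IsBounded F ∧ ∀ v : V, p v ∈ frontier F

/-- The graph `F₄`: a triangle on the vertices `inl 0, inl 1, inl 2`, and for each `j` an ear
`inr j`, a vertex joined exactly to the two ends of the triangle edge opposite to `inl j`. -/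
def F₄ : SimpleGraph (Fin 3 ⊕ Fin 3) :=
  SimpleGraph.fromRel fun x y => match x, y with
    | Sum.inl i, Sum.inl j => i ≠ j
    | Sum.inl i, Sum.inr j => i ≠ j
    | _, _ => False

end ChordalOuterplanar

namespace ChordalOuterplanar

open Set

/-! ### Straight-line outerplane drawings -/

section Drawing

variable {V : Type*} {G : SimpleGraph V} {p : V → Plane}

/-! The lower bounds are explicit cliques of the square: a closed neighbourhood of a vertex of
maximum degree, and the six vertices of `F₄`, which has diameter two. It remains to colour the
square with `Δ + 1` colours (`Δ + 2` in the exceptional case), that is, to make every closed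
neighbourhood rainbow (`Rainbow`).

Outerplanarity enters only through two consequences: there is no clique on four vertices, and no
edge lies in three triangles (`IsGood`). Chordality supplies simplicial vertices, and makes
neighbourhoods connected once cut vertices are gone; at a cut vertex, colourings are glued by
permuting colours (`Rainbow.glue`). In the remaining case of `IsGood.exists_rainbow` the simplicial
vertices are ears, each on an edge `ut`, and every neighbourhood induces a connected graph of
maximum degree at most two.

An ear can be coloured last when `deg u + deg t ≤ Δ + 3` (`IsGood.card_ear_le`). This is automatic
for `Δ ≤ 3`; for `Δ = 4` its failure produces `F₄`; for `Δ ≥ 7`, peeling off simplicial vertices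
twice exhibits such an ear (`IsGood.exists_light_ear`). For `Δ = 5` and `Δ = 6` the colours are the
vertices of a triangulated surface, the projective plane with `K₆` or the torus with `K₇`. The graph
is unfolded over it triangle by triangle (`IsGood.exists_develops`); a path in the neighbourhood of
a vertex then runs around the image vertex without turning back and is too short to close up
(`Develops.rainbow`). -/

theorem mem_segment_of_combination_eq_zero {E : Type*} [AddCommGroup E] [Module ℝ E]
    {a b x : E} {α β : ℝ} (hα : 0 ≤ α) (hβ : 0 ≤ β) (hs : α + β = 1) (hx : x = α • a + β • b) :
    x ∈ segment ℝ a b :=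
  ⟨α, β, hα, hβ, hs, hx.symm⟩

theorem IsPlaneDrawing.affineIndependent (hp : IsPlaneDrawing G p) {u v y : V}
    (huv : G.Adj u v) (huy : G.Adj u y) (hvy : G.Adj v y) :
    AffineIndependent ℝ ![p u, p v, p y] := by
  rw [affineIndependent_iff_not_collinear_set]
  intro hc
  rcases hc.wbtw_or_wbtw_or_wbtw with h | h | h <;> rw [← mem_segment_iff_wbtw] at h
  · exact hp.vertex_notMem_edge u y v huy huv.ne' hvy.ne h
  · exact hp.vertex_notMem_edge v u y huv.symm hvy.ne' huy.ne' h
  · exact hp.vertex_notMem_edge y v u hvy.symm huy.ne huv.ne h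

/-- Barycentric coordinates with respect to a triangle of the drawing. -/
theorem IsPlaneDrawing.exists_affineBasis (hp : IsPlaneDrawing G p) {u v y : V}
    (huv : G.Adj u v) (huy : G.Adj u y) (hvy : G.Adj v y) :
    ∃ b : AffineBasis (Fin 3) ℝ Plane, b 0 = p u ∧ b 1 = p v ∧ b 2 = p y := by
  have hi := hp.affineIndependent huv huy hvy
  refine ⟨⟨![p u, p v, p y], hi, ?_⟩, rfl, rfl, rfl⟩
  rw [hi.affineSpan_eq_top_iff_card_eq_finrank_add_one]
  simp

theorem exists_barycentric (b : AffineBasis (Fin 3) ℝ Plane) (x : Plane) :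
    b.coord 0 x + b.coord 1 x + b.coord 2 x = 1 ∧
      x = b.coord 0 x • b 0 + b.coord 1 x • b 1 + b.coord 2 x • b 2 := by
  have h1 := b.sum_coord_apply_eq_one x
  have h2 := b.linear_combination_coord_eq_self x
  rw [Fin.sum_univ_three] at h1 h2
  exact ⟨h1, h2.symm⟩

/-- A vertex in the interior of a triangle of the drawing is not on the boundary of an unbounded
face. -/
theorem IsPlaneDrawing.notMem_frontier_of_coord_pos {u v y z : V}
    (huv : G.Adj u v) (huy : G.Adj u y) (hvy : G.Adj v y) {F : Set Plane} (hF : IsFace G p F)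
    (hub : ¬ Bornology.IsBounded F) (b : AffineBasis (Fin 3) ℝ Plane)
    (h0 : b 0 = p u) (h1 : b 1 = p v) (h2 : b 2 = p y) (hz : ∀ i, 0 < b.coord i (p z)) :
    p z ∉ frontier F := by
  intro hfr
  set K := convexHull ℝ (range b) with hK
  have hKc : IsCompact K := (Set.finite_range b).isCompact_convexHull ℝ
  obtain ⟨x₀, -, rfl⟩ := hF
  set F := connectedComponentIn (drawing G p)ᶜ x₀
  -- The boundary of the triangle consists of drawn edges, so a face cannot meet it; being
  -- connected, the face lies wholly inside or wholly outside.
  have hsub : F ⊆ Kᶜ ∪ interior K := by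
    intro x hx
    have hxd : x ∉ drawing G p := connectedComponentIn_subset _ _ hx
    by_contra hcon
    rw [mem_union, not_or, mem_compl_iff, not_not] at hcon
    obtain ⟨hxK, hxI⟩ := hcon
    rw [hK, b.convexHull_eq_nonneg_coord] at hxK
    rw [hK, b.interior_convexHull] at hxI
    simp only [mem_ofPred_eq, not_forall, not_lt] at hxI hxK
    obtain ⟨i, hi⟩ := hxI
    have hi0 : b.coord i x = 0 := le_antisymm hi (hxK i)
    obtain ⟨hs, hx'⟩ := exists_barycentric b x
    have k0 := hxK 0
    have k1 := hxK 1
    have k2 := hxK 2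
    rw [h0, h1, h2] at hx'
    apply hxd
    right
    fin_cases i <;> simp only [Fin.zero_eta, Fin.mk_one, Fin.reduceFinMk] at hi0 <;>
      rw [hi0] at hx' hs
    · exact ⟨v, y, hvy, mem_segment_of_combination_eq_zero k1 k2 (by linarith) (by simpa using hx')⟩
    · exact ⟨u, y, huy, mem_segment_of_combination_eq_zero k0 k2 (by linarith) (by simpa using hx')⟩
    · exact ⟨u, v, huv, mem_segment_of_combination_eq_zero k0 k1 (by linarith) (by simpa using hx')⟩
  have hzI : p z ∈ interior K := by
    rw [hK, b.interior_convexHull]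
    exact hz
  have hne : (F ∩ interior K).Nonempty := by
    have := mem_closure_iff.1 (frontier_subset_closure hfr) _ isOpen_interior hzI
    rwa [inter_comm] at this
  have hFI : F ⊆ interior K :=
    IsPreconnected.subset_right_of_subset_union hKc.isClosed.isOpen_compl isOpen_interior
      (disjoint_compl_left.mono_right interior_subset) hsub hne isPreconnected_connectedComponentIn
  exact hub (hKc.isBounded.subset (hFI.trans interior_subset))

/-- If `u v x` and `u v y` are triangles of an outerplane drawing, then `x` and `y` lie on
different sides of `u v`. -/
theorem IsPlaneDrawing.coord_nonpos (hp : IsPlaneDrawing G p) {F : Set Plane}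
    (hF : IsFace G p F) (hub : ¬ Bornology.IsBounded F) (hfr : ∀ v, p v ∈ frontier F)
    {u v x y : V} (huv : G.Adj u v) (hux : G.Adj u x) (hvx : G.Adj v x) (huy : G.Adj u y)
    (hvy : G.Adj v y) (hxy : x ≠ y) (α β γ : ℝ) (hs : α + β + γ = 1)
    (hx : p x = α • p u + β • p v + γ • p y) : γ ≤ 0 := by
  by_contra! hγ
  obtain ⟨b, b0, b1, b2⟩ := hp.exists_affineBasis huv huy hvy
  obtain ⟨b', b0', b1', b2'⟩ := hp.exists_affineBasis huv hux hvx
  -- Barycentric coordinates are unique.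
  have key : ∀ (b : AffineBasis (Fin 3) ℝ Plane) (z : Plane) (α β γ : ℝ), α + β + γ = 1 →
      z = α • b 0 + β • b 1 + γ • b 2 → b.coord 0 z = α ∧ b.coord 1 z = β ∧ b.coord 2 z = γ := by
    intro b z α β γ hs hz
    obtain ⟨hs', hz'⟩ := exists_barycentric b z
    have hind := (affineIndependent_iff_of_fintype ℝ b).1 b.ind
      ![b.coord 0 z - α, b.coord 1 z - β, b.coord 2 z - γ]
      (by simp [Fin.sum_univ_three]; linarith)
      (by
        rw [Finset.weightedVSub_eq_weightedVSubOfPoint_of_sum_eq_zero _ _ _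
          (by simp [Fin.sum_univ_three]; linarith) 0, Finset.weightedVSubOfPoint_apply]
        simp only [Fin.sum_univ_three, Matrix.cons_val, vsub_eq_sub, sub_zero]
        have : b.coord 0 z • b 0 + b.coord 1 z • b 1 + b.coord 2 z • b 2 =
          α • b 0 + β • b 1 + γ • b 2 := by rw [← hz', ← hz]
        rw [sub_smul, sub_smul, sub_smul]
        rw [← sub_eq_zero] at this
        rw [← this]; abel)
    have i0 := hind 0
    have i1 := hind 1
    have i2 := hind 2
    simp only [Matrix.cons_val] at i0 i1 i2
    exact ⟨by linarith, by linarith, by linarith⟩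
  have hcross : ∀ (a c d e : V), G.Adj a c → G.Adj d e → a ≠ d → a ≠ e →
      ∀ s t q r : ℝ, 0 < s → 0 < t → 0 < q → 0 < r → s + t = q + r →
        s • p a + t • p c = q • p d + r • p e → False := by
    intro a c d e hac hde had hae s t q r hs ht hq hr hsum heq
    have hne : s(a, c) ≠ s(d, e) := by
      intro h
      rw [Sym2.eq_iff] at h
      rcases h with h | h
      · exact had h.1
      · exact hae h.1
    have hpos : 0 < s + t := by positivity
    refine Set.disjoint_left.1 (hp.edges_disjoint a c d e hac hde hne)
      (?_ : (s + t)⁻¹ • (s • p a + t • p c) ∈ _) ?_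
    · exact ⟨(s + t)⁻¹ * s, (s + t)⁻¹ * t, by positivity, by positivity, by field_simp,
        by rw [smul_add, smul_smul, smul_smul]⟩
    · refine ⟨(s + t)⁻¹ * q, (s + t)⁻¹ * r, by positivity, by positivity, ?_,
        by rw [heq, smul_add, smul_smul, smul_smul]⟩
      rw [← mul_add, ← hsum]; field_simp
  -- With `γ > 0` the points `x` and `y` lie on the same side of `uv`. The signs of `α` and `β`
  -- decide the contradiction: equal signs put one of the two inside the other's triangle, opposite
  -- signs make two edges cross, and a zero puts a vertex on an edge or gives `x = y`.
  rcases lt_trichotomy α 0 with hα | hα | hα <;> rcases lt_trichotomy β 0 with hβ | hβ | hβ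
  · -- `y` is inside `u v x`
    refine notMem_frontier_of_coord_pos huv hux hvx hF hub b' b0' b1' b2' (z := y) ?_ (hfr y)
    obtain ⟨c0, c1, c2⟩ := key b' (p y) (-α / γ) (-β / γ) (1 / γ) (by field_simp; linarith)
      (by
        rw [b0', b1', b2', hx]
        simp only [smul_add, smul_smul]
        have e1 : 1 / γ * α = -(-α / γ) := by ring
        have e2 : 1 / γ * β = -(-β / γ) := by ring
        have e3 : 1 / γ * γ = 1 := by field_simp
        rw [e1, e2, e3, neg_smul, neg_smul, one_smul]; abel)
    intro i
    fin_cases i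
    · simp only [Fin.zero_eta, c0]; exact div_pos (by linarith) hγ
    · simp only [Fin.mk_one, c1]; exact div_pos (by linarith) hγ
    · simp only [Fin.reduceFinMk, c2]; positivity
  · -- `y` lies on the edge `u x`
    subst hβ
    refine hp.vertex_notMem_edge u x y hux huy.ne' hxy.symm
      ⟨-α / γ, 1 / γ, (div_pos (by linarith) hγ).le, by positivity, by field_simp; linarith, ?_⟩
    rw [hx]
    simp only [smul_add, smul_smul, zero_smul, add_zero]
    have e1 : 1 / γ * α = -(-α / γ) := by ring
    have e3 : 1 / γ * γ = 1 := by field_simp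
    rw [e1, e3, neg_smul, one_smul]; abel
  · refine hcross x u v y hux.symm hvy hvx.ne' hxy 1 (-α) β γ one_pos (by linarith) hβ hγ
      (by linarith) ?_
    rw [hx, one_smul, neg_smul]; abel
  · subst hα
    refine hp.vertex_notMem_edge v x y hvx hvy.ne' hxy.symm
      ⟨-β / γ, 1 / γ, (div_pos (by linarith) hγ).le, by positivity, by field_simp; linarith, ?_⟩
    rw [hx]
    simp only [smul_add, smul_smul, zero_smul, zero_add]
    have e1 : 1 / γ * β = -(-β / γ) := by ring
    have e3 : 1 / γ * γ = 1 := by field_simp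
    rw [e1, e3, neg_smul, one_smul]; abel
  · subst hα hβ
    have : γ = 1 := by linarith
    subst this
    exact hxy (hp.injective (by simpa using hx))
  · subst hα
    exact hp.vertex_notMem_edge v y x hvy hvx.ne' hxy
      ⟨β, γ, hβ.le, hγ.le, by linarith, by rw [hx, zero_smul, zero_add]⟩
  · refine hcross x v u y hvx.symm huy hux.ne' hxy 1 (-β) α γ one_pos (by linarith) hα hγ
      (by linarith) ?_
    rw [hx, one_smul, neg_smul]; abel
  · subst hβ
    exact hp.vertex_notMem_edge u y x huy hux.ne' hxy
      ⟨α, γ, hα.le, hγ.le, by linarith, by rw [hx, zero_smul, add_zero]⟩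
  · refine notMem_frontier_of_coord_pos huv huy hvy hF hub b b0 b1 b2 (z := x) ?_ (hfr x)
    obtain ⟨c0, c1, c2⟩ := key b (p x) α β γ hs (by rw [b0, b1, b2, hx])
    intro i
    fin_cases i
    · simpa only [Fin.zero_eta, c0] using hα
    · simpa only [Fin.mk_one, c1] using hβ
    · simpa only [Fin.reduceFinMk, c2] using hγ

/-- By `coord_nonpos` on each side of the triangle `abc`, all three barycentric coordinates of `d`
are nonpositive, yet they sum to one. -/
theorem IsOuterplanar.not_four_clique (h : IsOuterplanar G) {a b c d : V} (hab : G.Adj a b)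
    (hac : G.Adj a c) (had : G.Adj a d) (hbc : G.Adj b c) (hbd : G.Adj b d) (hcd : G.Adj c d) :
    False := by
  obtain ⟨p, hp, F, hF, hub, hfr⟩ := h
  obtain ⟨B, b0, b1, b2⟩ := hp.exists_affineBasis hab hac hbc
  obtain ⟨hs, hx⟩ := exists_barycentric B (p d)
  rw [b0, b1, b2] at hx
  have h2 := hp.coord_nonpos hF hub hfr hab had hbd hac hbc hcd.ne' _ _ _ hs hx
  have h1 := hp.coord_nonpos hF hub hfr hac had hcd hab hbc.symm hbd.ne'
    (B.coord 0 (p d)) (B.coord 2 (p d)) (B.coord 1 (p d)) (by linarith)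
    (by nth_rewrite 1 [hx]; abel)
  have h0 := hp.coord_nonpos hF hub hfr hbc hbd hcd hab.symm hac.symm had.ne'
    (B.coord 1 (p d)) (B.coord 2 (p d)) (B.coord 0 (p d)) (by linarith)
    (by nth_rewrite 1 [hx]; abel)
  linarith

/-- The line `uv` has only two sides, and three apexes would have to lie on pairwise different ones.
-/
theorem IsOuterplanar.not_three_common (h : IsOuterplanar G) {u v x y z : V} (huv : G.Adj u v)
    (hux : G.Adj u x) (hvx : G.Adj v x) (huy : G.Adj u y) (hvy : G.Adj v y) (huz : G.Adj u z)
    (hvz : G.Adj v z) (hxy : x ≠ y) (hxz : x ≠ z) (hyz : y ≠ z) : False := by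
  obtain ⟨p, hp, F, hF, hub, hfr⟩ := h
  obtain ⟨B, b0, b1, b2⟩ := hp.exists_affineBasis huv huz hvz
  obtain ⟨hsx, hx⟩ := exists_barycentric B (p x)
  obtain ⟨hsy, hy⟩ := exists_barycentric B (p y)
  rw [b0, b1, b2] at hx hy
  have hx2 := hp.coord_nonpos hF hub hfr huv hux hvx huz hvz hxz _ _ _ hsx hx
  have hy2 := hp.coord_nonpos hF hub hfr huv huy hvy huz hvz hyz _ _ _ hsy hy
  set α := B.coord 0 (p x)
  set β := B.coord 1 (p x)
  set γ := B.coord 2 (p x)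
  set α' := B.coord 0 (p y)
  set β' := B.coord 1 (p y)
  set γ' := B.coord 2 (p y)
  have hne : ∀ (q : V), G.Adj u q → G.Adj v q → ∀ a b c : ℝ, a + b + c = 1 →
      p q = a • p u + b • p v + c • p z → c ≠ 0 := by
    rintro q huq hvq a b c hs hq rfl
    have hind := hp.affineIndependent huv huq hvq
    rw [affineIndependent_iff_not_collinear_set] at hind
    apply hind
    have : p q ∈ line[ℝ, p u, p v] := by
      have h : p q = AffineMap.lineMap (p u) (p v) b := by
        rw [AffineMap.lineMap_apply_module, hq]
        have : a = 1 - b := by linarith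
        rw [this, zero_smul, add_zero]
      rw [h]
      exact AffineMap.lineMap_mem_affineSpan_pair _ _ _
    have hc := collinear_insert_of_mem_affineSpan_pair this
    refine hc.subset ?_
    intro t ht
    simp only [mem_insert_iff, mem_singleton_iff] at ht ⊢
    tauto
  have hx0 : γ < 0 := lt_of_le_of_ne hx2 (hne x hux hvx α β γ hsx hx)
  have hy0 : γ' < 0 := lt_of_le_of_ne hy2 (hne y huy hvy α' β' γ' hsy hy)
  have hpos : 0 < γ / γ' := div_pos_of_neg_of_neg hx0 hy0
  -- Eliminating `z` expresses `x` through `u`, `v`, `y`; the coefficient of `y` is a quotient of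
  -- two negative numbers.
  have := hp.coord_nonpos hF hub hfr huv hux hvx huy hvy hxy
    (α - γ / γ' * α') (β - γ / γ' * β') (γ / γ')
    (by
      have : α' + β' = 1 - γ' := by linarith
      have h3 : γ / γ' * γ' = γ := div_mul_cancel₀ _ hy0.ne
      linear_combination hsx - γ / γ' * this + h3)
    (by
      rw [hx, hy]
      simp only [smul_add, smul_smul, sub_smul]
      have h3 : γ / γ' * γ' = γ := div_mul_cancel₀ _ hy0.ne
      rw [h3]; abel)
  linarith

end Drawing

/-! ### Geodesics and induced cycles -/

section Chordal

variable {V : Type*} {G : SimpleGraph V}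

/-- The graph on the same vertices that keeps only the edges of `G` with both ends in `S`. -/
def inside (G : SimpleGraph V) (S : Set V) : SimpleGraph V where
  Adj a b := G.Adj a b ∧ a ∈ S ∧ b ∈ S
  symm := ⟨fun _ _ h => ⟨h.1.symm, h.2.2, h.2.1⟩⟩
  loopless := ⟨fun _ h => h.1.ne rfl⟩

theorem inside_mono {S T : Set V} (h : S ⊆ T) : inside G S ≤ inside G T :=
  fun _ _ hab => ⟨hab.1, h hab.2.1, h hab.2.2⟩

/-- A shortest walk, listed as a sequence. Splicing a shorter walk between two of its vertices would
shorten the whole, so it is injective and chordless and each of its segments is again shortest. -/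
theorem exists_geodesic {H : SimpleGraph V} {x y : V} (h : H.Reachable x y) :
    ∃ (k : ℕ) (p : ℕ → V), p 0 = x ∧ p k = y ∧ (∀ i < k, H.Adj (p i) (p (i + 1))) ∧
      (∀ i j, i ≤ j → j ≤ k → p i = p j → i = j) ∧
      (∀ i j, i ≤ j → j ≤ k → H.Adj (p i) (p j) → j = i + 1) ∧
      (∀ i j, i ≤ j → j ≤ k → H.Reachable (p i) (p j) ∧ H.dist (p i) (p j) = j - i) := by
  obtain ⟨w, hw⟩ := h.exists_walk_length_eq_dist
  have hadj : ∀ i < w.length, H.Adj (w.getVert i) (w.getVert (i + 1)) :=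
    fun i hi => w.adj_getVert_succ hi
  have hup : ∀ i m, i + m ≤ w.length →
      ∃ q : H.Walk (w.getVert i) (w.getVert (i + m)), q.length = m := by
    intro i m
    induction m with
    | zero => exact fun _ => ⟨.nil, rfl⟩
    | succ m ih =>
      intro hm
      obtain ⟨q, hq⟩ := ih (by omega)
      exact ⟨q.concat (hadj (i + m) (by omega)), by simp [hq]⟩
  have hlow : ∀ i j, i ≤ j → j ≤ w.length →
      ∀ q : H.Walk (w.getVert i) (w.getVert j), j - i ≤ q.length := by
    intro i j hij hj q
    obtain ⟨a, ha⟩ := hup 0 i (by omega)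
    obtain ⟨b, hb⟩ := hup j (w.length - j) (by omega)
    have h1 := SimpleGraph.dist_le
      ((a.copy (by simp) (by simp)).append (q.append (b.copy rfl
        (by rw [Nat.add_sub_cancel' hj, w.getVert_length]))) : H.Walk x y)
    rw [SimpleGraph.Walk.length_append, SimpleGraph.Walk.length_append,
      SimpleGraph.Walk.length_copy, SimpleGraph.Walk.length_copy] at h1
    omega
  refine ⟨w.length, w.getVert, by simp, by simp, hadj, ?_, ?_, ?_⟩
  · intro i j hij hj h
    have := hlow i j hij hj (SimpleGraph.Walk.nil.copy rfl h)
    simp at this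
    omega
  · intro i j hij hj h
    have := hlow i j hij hj h.toWalk
    simp only [SimpleGraph.Walk.length_cons, SimpleGraph.Walk.length_nil] at this
    rcases hij.eq_or_lt with rfl | hlt
    · exact absurd rfl h.ne
    · omega
  · intro i j hij hj
    obtain ⟨q, hq⟩ := hup i (j - i) (by omega)
    have hr : H.Reachable (w.getVert i) (w.getVert j) :=
      ⟨q.copy rfl (by rw [Nat.add_sub_cancel' hij])⟩
    refine ⟨hr, le_antisymm ?_ ?_⟩
    · have := SimpleGraph.dist_le (q.copy rfl (by rw [Nat.add_sub_cancel' hij]) :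
        H.Walk (w.getVert i) (w.getVert j))
      rwa [SimpleGraph.Walk.length_copy, hq] at this
    · obtain ⟨r, hr'⟩ := hr.exists_walk_length_eq_dist
      rw [← hr']
      exact hlow i j hij hj r

theorem cycleGraph_adj_of_lt {n : ℕ} {u v : Fin n} (h : u < v) :
    (SimpleGraph.cycleGraph n).Adj u v ↔ v.val = u.val + 1 ∨ (u.val = 0 ∧ v.val + 1 = n) := by
  rw [SimpleGraph.cycleGraph_adj', Fin.coe_sub_iff_lt.2 h, Fin.sub_val_of_le h.le]
  have := v.isLt
  have : u.val < v.val := h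
  omega

/-- A chordless path whose ends, and no other vertices, are adjacent to `w` closes up to an
induced cycle. -/
theorem IsChordal.not_chordless_path (hG : IsChordal G) {w : V} {k : ℕ} (hk : 2 ≤ k) {p : ℕ → V}
    (hinj : ∀ i j, i ≤ j → j ≤ k → p i = p j → i = j)
    (hadj : ∀ i j, i ≤ j → j ≤ k → (G.Adj (p i) (p j) ↔ j = i + 1))
    (hne : ∀ i ≤ k, p i ≠ w) (hw : ∀ i ≤ k, (G.Adj (p i) w ↔ i = 0 ∨ i = k)) : False := by
  classical
  -- The path fills positions `0` to `k` and `w` takes position `k + 1`; `2 ≤ k` makes the cycle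
  -- long enough to contradict chordality.
  let f : Fin (k + 2) → V := fun i => if i.val ≤ k then p i else w
  have hinj' : ∀ i j : Fin (k + 2), i < j → f i ≠ f j := by
    intro i j hij
    have h1 : i.val ≤ k := by have : i.val < j.val := hij; omega
    simp only [f, h1, if_true]
    split_ifs with h2
    · intro h
      have := hinj i j hij.le h2 h
      have : i.val < j.val := hij
      omega
    · exact hne _ h1
  have hadj' : ∀ i j : Fin (k + 2), i < j →
      (G.Adj (f i) (f j) ↔ (SimpleGraph.cycleGraph (k + 2)).Adj i j) := by
    intro i j hij
    have hij' : i.val < j.val := hij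
    have h1 : i.val ≤ k := by omega
    rw [cycleGraph_adj_of_lt hij]
    simp only [f, h1, if_true]
    split_ifs with h2
    · rw [hadj i j hij'.le h2]; omega
    · rw [hw i h1]; omega
  refine hG (k + 2) (by omega) ⟨⟨⟨f, ?_⟩, ?_⟩⟩
  · intro i j h
    rcases lt_trichotomy i j with hl | hl | hl
    · exact absurd h (hinj' i j hl)
    · exact hl
    · exact absurd h.symm (hinj' j i hl)
  · intro i j
    change G.Adj (f i) (f j) ↔ _
    rcases lt_trichotomy i j with hl | rfl | hl
    · exact hadj' i j hl
    · simp
    · rw [G.adj_comm, SimpleGraph.adj_comm _ i]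
      exact hadj' j i hl

/-- In a chordal graph, two neighbours of `w` that are joined by a path avoiding `w` are joined by
a path inside the neighbourhood of `w`. -/
theorem IsChordal.reachable_inter_neighbors (hG : IsChordal G) {w : V} {S : Set V} (hw : w ∉ S)
    {x y : V} (hxS : x ∈ S) (hx : G.Adj w x) (hy : G.Adj w y)
    (h : (inside G S).Reachable x y) :
    (inside G (S ∩ {z | G.Adj w z})).Reachable x y := by
  induction hn : (inside G S).dist x y using Nat.strong_induction_on generalizing x y with
  | _ n ih =>
    obtain ⟨k, p, rfl, rfl, hpadj, hpinj, hpch, hpd⟩ := exists_geodesic h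
    have hk : k = n := by rw [← hn, (hpd 0 k (Nat.zero_le _) le_rfl).2]; rfl
    subst hk
    have hpS : ∀ i ≤ k, p i ∈ S := by
      intro i hi
      rcases Nat.eq_zero_or_pos i with rfl | hi0
      · exact hxS
      · have := (hpadj (i - 1) (by omega)).2.2
        rwa [Nat.sub_add_cancel hi0] at this
    by_cases hk0 : k = 0
    · subst hk0; exact .refl _
    by_cases hk1 : k = 1
    · subst hk1
      have := (hpadj 0 one_pos)
      exact SimpleGraph.Adj.reachable ⟨this.1, ⟨this.2.1, hx⟩, ⟨this.2.2, hy⟩⟩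
    -- An inner vertex of the geodesic adjacent to `w` splits the problem into two shorter ones;
    -- without such a vertex, the geodesic closes up through `w` to an induced cycle.
    by_cases hmid : ∃ i, 0 < i ∧ i < k ∧ G.Adj w (p i)
    · obtain ⟨i, hi0, hik, hi⟩ := hmid
      have h1 := hpd 0 i (by omega) (by omega)
      have h2 := hpd i k (by omega) (by omega)
      exact (ih i hik hxS hx hi h1.1 (by rw [h1.2]; rfl)).trans
        (ih (k - i) (by omega) (hpS i hik.le) hi hy h2.1 h2.2)
    · push Not at hmid
      exfalso
      refine hG.not_chordless_path (w := w) (k := k) (by omega) hpinj ?_ ?_ ?_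
      · intro i j hij hj
        constructor
        · intro h
          exact hpch i j hij hj ⟨h, hpS i (by omega), hpS j hj⟩
        · rintro rfl
          exact (hpadj i (by omega)).1
      · intro i hi h
        exact hw (h ▸ hpS i hi)
      · intro i hi
        constructor
        · intro h
          by_contra hcon
          exact hmid i (by omega) (by omega) h.symm
        · rintro (rfl | rfl)
          · exact hx.symm
          · exact hy.symm

/-! ### Simplicial vertices -/

/-- The neighbours of `v` in `T` form a clique. -/
def IsSimplicialIn (G : SimpleGraph V) (T : Finset V) (v : V) : Prop :=
  ∀ x ∈ T, ∀ y ∈ T, G.Adj v x → G.Adj v y → x ≠ y → G.Adj x y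

/-- Dirac's theorem. The second half, a simplicial vertex away from any prescribed non-universal
`w`, is the strengthening that lets the induction run. -/
theorem IsChordal.exists_isSimplicialIn_aux (hG : IsChordal G) (T : Finset V) :
    (T.Nonempty → ∃ v ∈ T, IsSimplicialIn G T v) ∧
    ∀ w ∈ T, (∃ z ∈ T, z ≠ w ∧ ¬ G.Adj w z) → ∃ v ∈ T, v ≠ w ∧ ¬ G.Adj w v ∧ IsSimplicialIn G T v := by
  classical
  induction T using Finset.strongInduction with
  | H T ih =>
  have main : ∀ w ∈ T, (∃ z ∈ T, z ≠ w ∧ ¬ G.Adj w z) →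
      ∃ v ∈ T, v ≠ w ∧ ¬ G.Adj w v ∧ IsSimplicialIn G T v := by
    rintro w hw ⟨z, hz, hzw, hwz⟩
    -- `C` is the component of `z` among the non-neighbours of `w`, and `S` is its attachment among
    -- the neighbours of `w`. A vertex of `C` has all its neighbours in `C ∪ S`, so being simplicial
    -- there suffices.
    let R : Set V := {a | a ∈ T ∧ a ≠ w ∧ ¬ G.Adj w a}
    let C : Finset V := T.filter fun a => a ∈ R ∧ (inside G R).Reachable z a
    let S : Finset V := T.filter fun a => G.Adj w a ∧ ∃ c ∈ C, G.Adj a c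
    have hzC : z ∈ C := by simp [C, R, hz, hzw, hwz]
    have hCR : ∀ c ∈ C, c ∈ R := fun c hc => (Finset.mem_filter.1 hc).2.1
    have hCconn : ∀ c ∈ C, (inside G (C : Set V)).Reachable z c := by
      intro c hc
      obtain ⟨q⟩ := (Finset.mem_filter.1 hc).2.2
      have : ∀ {a b : V} (q : (inside G R).Walk a b), a ∈ C →
          (inside G (C : Set V)).Reachable a b := by
        intro a b q
        induction q with
        | nil => exact fun _ => .refl _
        | @cons a b _ hadj q ih =>
          intro ha
          have hb : b ∈ C := Finset.mem_filter.2
            ⟨hadj.2.2.1, hadj.2.2, (Finset.mem_filter.1 ha).2.2.trans hadj.reachable⟩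
          have hab : (inside G (C : Set V)).Adj a b := ⟨hadj.1, ha, hb⟩
          exact hab.reachable.trans (ih hb)
      exact this q hzC
    have hCnb : ∀ c ∈ C, ∀ a ∈ T, G.Adj c a → a ∈ C ∪ S := by
      intro c hc a ha hca
      have hcR := hCR c hc
      by_cases haw : a = w
      · subst haw
        exact absurd hca.symm hcR.2.2
      by_cases hwa : G.Adj w a
      · exact Finset.mem_union_right _ (Finset.mem_filter.2 ⟨ha, hwa, c, hc, hca.symm⟩)
      · refine Finset.mem_union_left _ (Finset.mem_filter.2 ⟨ha, ⟨ha, haw, hwa⟩, ?_⟩)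
        have hca' : (inside G R).Adj c a := ⟨hca, hcR, ha, haw, hwa⟩
        exact (Finset.mem_filter.1 hc).2.2.trans hca'.reachable
    have hSclique : ∀ x ∈ S, ∀ y ∈ S, x ≠ y → G.Adj x y := by
      intro x hx y hy hxy
      obtain ⟨hxT, hwx, c, hc, hxc⟩ := Finset.mem_filter.1 hx
      obtain ⟨hyT, hwy, d, hd, hyd⟩ := Finset.mem_filter.1 hy
      let U : Set V := (C : Set V) ∪ {x, y}
      have hcd : (inside G U).Reachable x y := by
        have h1 : (inside G U).Adj x c := ⟨hxc, by simp [U], by simp [U, hc]⟩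
        have h2 : (inside G U).Adj d y := ⟨hyd.symm, by simp [U, hd], by simp [U]⟩
        have h3 : (inside G U).Reachable c d :=
          ((hCconn c hc).symm.trans (hCconn d hd)).mono (inside_mono subset_union_left)
        exact h1.reachable.trans (h3.trans h2.reachable)
      have hwU : w ∉ U := by
        rintro (h | h | h)
        · exact (hCR w h).2.1 rfl
        · exact hwx.ne h
        · exact hwy.ne h
      -- No vertex of `C` is adjacent to `w`, so a path from `x` to `y` within the neighbourhood of
      -- `w` can use only `x` and `y` themselves.
      have hr := hG.reachable_inter_neighbors hwU (x := x) (y := y) (by simp [U]) hwx hwy hcd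
      have hsub : U ∩ {z | G.Adj w z} ⊆ {x, y} := by
        rintro a ⟨h | h, ha⟩
        · exact absurd ha (hCR a h).2.2
        · exact h
      obtain ⟨q⟩ := hr.mono (inside_mono hsub)
      cases q with
      | nil => exact absurd rfl hxy
      | cons h _ =>
        rcases h.2.2 with h' | h'
        · exact absurd h'.symm h.ne
        · exact h' ▸ h.1
    have hwCS : w ∉ C ∪ S := by
      rw [Finset.mem_union, not_or]
      refine ⟨fun h => (hCR w h).2.1 rfl, fun h => ?_⟩
      exact (Finset.mem_filter.1 h).2.1.ne rfl
    have hCST : C ∪ S ⊂ T :=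
      ⟨Finset.union_subset (Finset.filter_subset _ _) (Finset.filter_subset _ _),
        fun h => hwCS (h hw)⟩
    have hlift : ∀ v ∈ C, IsSimplicialIn G (C ∪ S) v →
        ∃ v ∈ T, v ≠ w ∧ ¬ G.Adj w v ∧ IsSimplicialIn G T v := by
      intro v hv hs
      have hvR := hCR v hv
      refine ⟨v, hvR.1, hvR.2.1, hvR.2.2, fun x hx y hy hvx hvy hxy => ?_⟩
      exact hs x (hCnb v hv x hx hvx) y (hCnb v hv y hy hvy) hvx hvy hxy
    -- If `S` is complete to `C`, a simplicial vertex of `C` stays simplicial in `C ∪ S`. Otherwise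
    -- some `s ∈ S` misses a vertex of `C`, and the simplicial vertex found away from `s` cannot lie
    -- in the clique `S`.
    by_cases hall : ∀ s ∈ S, ∀ c ∈ C, G.Adj s c
    · have hCT : C ⊂ T := Finset.ssubset_of_subset_of_ssubset Finset.subset_union_left hCST
      obtain ⟨v, hv, hvs⟩ := (ih C hCT).1 ⟨z, hzC⟩
      refine hlift v hv fun x hx y hy hvx hvy hxy => ?_
      rcases Finset.mem_union.1 hx with hx | hx <;> rcases Finset.mem_union.1 hy with hy | hy
      · exact hvs x hx y hy hvx hvy hxy
      · exact (hall y hy x hx).symm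
      · exact hall x hx y hy
      · exact hSclique x hx y hy hxy
    · push Not at hall
      obtain ⟨s, hs, c, hc, hsc⟩ := hall
      have hsC : s ∉ C := fun h => (hCR s h).2.2 (Finset.mem_filter.1 hs).2.1
      obtain ⟨v, hv, hvs, hsv, hvsim⟩ := (ih _ hCST).2 s (Finset.mem_union_right _ hs)
        ⟨c, Finset.mem_union_left _ hc, fun h => hsC (h ▸ hc), hsc⟩
      rcases Finset.mem_union.1 hv with hv | hv
      · exact hlift v hv hvsim
      · exact absurd (hSclique s hs v hv hvs.symm) hsv
  refine ⟨?_, main⟩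
  rintro ⟨w, hw⟩
  by_cases h : ∃ w ∈ T, ∃ z ∈ T, z ≠ w ∧ ¬ G.Adj w z
  · obtain ⟨w, hw, hz⟩ := h
    obtain ⟨v, hv, -, -, hs⟩ := main w hw hz
    exact ⟨v, hv, hs⟩
  · push Not at h
    exact ⟨w, hw, fun x hx y hy _ _ hxy => h x hx y hy hxy.symm⟩

/-- Every nonempty set of vertices of a chordal graph contains a simplicial vertex. -/
theorem IsChordal.exists_isSimplicialIn (hG : IsChordal G) {T : Finset V} (hT : T.Nonempty) :
    ∃ v ∈ T, IsSimplicialIn G T v :=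
  (hG.exists_isSimplicialIn_aux T).1 hT

end Chordal

/-! ### Colourings in which closed neighbourhoods are rainbow -/

section Rainbow

variable {V : Type*} {G : SimpleGraph V}

open scoped Classical in
/-- The neighbours of `w` in `T`. -/
noncomputable def nb (G : SimpleGraph V) (T : Finset V) (w : V) : Finset V := T.filter (G.Adj w)

@[simp] theorem mem_nb {T : Finset V} {w x : V} : x ∈ nb G T w ↔ x ∈ T ∧ G.Adj w x := by
  simp [nb]

theorem nb_mono {S T : Finset V} (h : S ⊆ T) (w : V) : nb G S w ⊆ nb G T w := by
  intro x hx
  rw [mem_nb] at hx ⊢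
  exact ⟨h hx.1, hx.2⟩

/-- The colouring `c` is injective on every closed neighbourhood of the subgraph of `G` induced on
`T`. -/
def Rainbow {α : Type*} (G : SimpleGraph V) (T : Finset V) (c : V → α) : Prop :=
  ∀ w ∈ T, ∀ x ∈ T, ∀ y ∈ T, x ≠ y → (x = w ∨ G.Adj w x) → (y = w ∨ G.Adj w y) → c x ≠ c y

/-- The combinatorial properties of chordal outerplanar graphs used for colouring the square. -/
structure IsGood (G : SimpleGraph V) : Prop where
  chordal : IsChordal G
  not_clique : ∀ {a b c d : V}, G.Adj a b → G.Adj a c → G.Adj a d → G.Adj b c → G.Adj b d →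
    G.Adj c d → False
  not_book : ∀ {u v x y z : V}, G.Adj u v → G.Adj u x → G.Adj v x → G.Adj u y → G.Adj v y →
    G.Adj u z → G.Adj v z → x ≠ y → x ≠ z → y ≠ z → False

theorem IsOuterplanar.isGood (ho : IsOuterplanar G) (hc : IsChordal G) : IsGood G :=
  ⟨hc, ho.not_four_clique, ho.not_three_common⟩

theorem IsGood.card_nb_le_two (hG : IsGood G) {T : Finset V} {v : V}
    (hv : IsSimplicialIn G T v) : (nb G T v).card ≤ 2 := by
  by_contra! h
  obtain ⟨a, b, c, ha, hb, hc, hab, hac, hbc⟩ := Finset.two_lt_card_iff.1 h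
  rw [mem_nb] at ha hb hc
  exact hG.not_clique ha.2 hb.2 hc.2 (hv a ha.1 b hb.1 ha.2 hb.2 hab)
    (hv a ha.1 c hc.1 ha.2 hc.2 hac) (hv b hb.1 c hc.1 hb.2 hc.2 hbc)

variable [DecidableEq V]

/-- Only vertices within distance two of `v` constrain its colour. Two neighbours of `v` are
adjacent because `v` is simplicial, so deleting `v` loses no constraint between older vertices. -/
theorem Rainbow.extend {n : ℕ} {T : Finset V} {v : V} (hv : IsSimplicialIn G T v)
    (S : Finset V)
    (hS : ∀ x ∈ T, x ≠ v → (G.Adj v x ∨ ∃ z ∈ T, G.Adj v z ∧ G.Adj z x) → x ∈ S)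
    (hcard : S.card ≤ n) {c : V → Fin (n + 1)} (hc : Rainbow G (T.erase v) c) :
    ∃ c : V → Fin (n + 1), Rainbow G T c := by
  obtain ⟨a, -, ha⟩ : ∃ a ∈ (Finset.univ : Finset (Fin (n + 1))), a ∉ S.image c := by
    refine Finset.exists_mem_notMem_of_card_lt_card ?_
    rw [Finset.card_univ, Fintype.card_fin]
    exact Nat.lt_succ_of_le (Finset.card_image_le.trans hcard)
  refine ⟨Function.update c v a, fun w hw x hx y hy hxy hwx hwy => ?_⟩
  have key : ∀ y ∈ T, y ≠ v → (v = w ∨ G.Adj w v) → (y = w ∨ G.Adj w y) → a ≠ c y := by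
    rintro y hy hyv hwv hwy rfl
    refine ha (Finset.mem_image_of_mem _ (hS y hy hyv ?_))
    rcases hwv with rfl | hwv
    · exact Or.inl (hwy.resolve_left hyv)
    · rcases hwy with rfl | hwy
      · exact Or.inl hwv.symm
      · exact Or.inr ⟨w, hw, hwv.symm, hwy⟩
  by_cases hxv : x = v
  · subst hxv
    rw [Function.update_self, Function.update_of_ne hxy.symm]
    exact key y hy hxy.symm hwx hwy
  by_cases hyv : y = v
  · subst hyv
    rw [Function.update_self, Function.update_of_ne hxy]
    exact (key x hx hxy hwy hwx).symm
  rw [Function.update_of_ne hxv, Function.update_of_ne hyv]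
  have hx' := Finset.mem_erase.2 ⟨hxv, hx⟩
  have hy' := Finset.mem_erase.2 ⟨hyv, hy⟩
  by_cases hwv : w = v
  · subst hwv
    exact hc x hx' x hx' y hy' hxy (Or.inl rfl)
      (Or.inr (hv x hx y hy (hwx.resolve_left hxv) (hwy.resolve_left hyv) hxy))
  · exact hc w (Finset.mem_erase.2 ⟨hwv, hw⟩) x hx' y hy' hxy hwx hwy

/-- Colourings of two parts that share a single vertex can be glued after permuting colours. -/
theorem Rainbow.glue {n : ℕ} {A B : Finset V} {w : V} (hwA : w ∈ A) (hwB : w ∈ B)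
    (hAB : ∀ a ∈ A, a ∈ B → a = w) (hno : ∀ a ∈ A, a ≠ w → ∀ b ∈ B, b ≠ w → ¬ G.Adj a b)
    (hdeg : (nb G (A ∪ B) w).card ≤ n) {cA cB : V → Fin (n + 1)} (hA : Rainbow G A cA)
    (hB : Rainbow G B cB) : ∃ c : V → Fin (n + 1), Rainbow G (A ∪ B) c := by
  have hdisj : Disjoint (nb G A w) (nb G B w) := by
    rw [Finset.disjoint_left]
    intro a ha hb
    rw [mem_nb] at ha hb
    exact ha.2.ne (hAB a ha.1 hb.1).symm
  have hsum : (nb G A w).card + (nb G B w).card ≤ n := by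
    rw [← Finset.card_union_of_disjoint hdisj]
    exact (Finset.card_le_card (Finset.union_subset (nb_mono Finset.subset_union_left w)
      (nb_mono Finset.subset_union_right w))).trans hdeg
  -- The colours of `B` are permuted so that `cB w` goes to `cA w` and `Q` goes outside `P`. There
  -- is room: `P` leaves at least `n` minus the degree of `w` in `A` colours free, and this is at
  -- least the degree of `w` in `B`.
  let P := (insert w (nb G A w)).image cA
  let Q := (nb G B w).image cB
  have hP : P.card ≤ (nb G A w).card + 1 :=
    Finset.card_image_le.trans (Finset.card_insert_le _ _)
  have hQ : Q.card ≤ (nb G B w).card := Finset.card_image_le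
  have hwQ : cB w ∉ Q := by
    intro h
    obtain ⟨b, hb, hbw⟩ := Finset.mem_image.1 h
    rw [mem_nb] at hb
    exact hB w hwB b hb.1 w hwB hb.2.ne' (Or.inr hb.2) (Or.inl rfl) hbw
  have hPc : Pᶜ.card = n + 1 - P.card := by rw [Finset.card_compl, Fintype.card_fin]
  obtain ⟨e⟩ : Nonempty (Q ↪ (Pᶜ : Finset (Fin (n + 1)))) := by
    apply Function.Embedding.nonempty_of_card_le
    rw [Fintype.card_coe, Fintype.card_coe]
    omega
  -- Since `cB w ∉ Q`, the default value is exactly the value needed at `cB w`.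
  let f : Fin (n + 1) → Fin (n + 1) := fun i => if h : i ∈ Q then (e ⟨i, h⟩ : Fin (n + 1)) else cA w
  have hfQ : ∀ i (h : i ∈ Q), f i = e ⟨i, h⟩ := fun i h => dif_pos h
  have hfw : f (cB w) = cA w := dif_neg hwQ
  have heP : ∀ i, (e i : Fin (n + 1)) ∉ P := fun i => Finset.mem_compl.1 (e i).2
  have hcP : cA w ∈ P := Finset.mem_image_of_mem _ (Finset.mem_insert_self _ _)
  have hinj : Set.InjOn f (insert (cB w) Q : Finset (Fin (n + 1))) := by
    intro i hi j hj hij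
    rw [Finset.mem_coe, Finset.mem_insert] at hi hj
    rcases hi with rfl | hi <;> rcases hj with rfl | hj
    · rfl
    · rw [hfw, hfQ j hj] at hij
      exact absurd (hij ▸ hcP) (heP _)
    · rw [hfw, hfQ i hi] at hij
      exact absurd (hij ▸ hcP) (heP _)
    · rw [hfQ i hi, hfQ j hj] at hij
      simpa using e.injective (Subtype.ext hij)
  obtain ⟨g, hg⟩ := Finset.exists_equiv_extend_of_card_eq
    (t := (Finset.univ : Finset (Fin (n + 1)))) (by simp) (Finset.subset_univ _) hinj
  let σ : Fin (n + 1) → Fin (n + 1) := fun i => g i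
  have hσ : Function.Injective σ := fun i j h => g.injective (Subtype.ext h)
  have hσw : σ (cB w) = cA w := (hg _ (Finset.mem_insert_self _ _)).trans hfw
  have hσQ : ∀ b ∈ nb G B w, σ (cB b) ∉ P := by
    intro b hb
    have hbQ : cB b ∈ Q := Finset.mem_image_of_mem _ hb
    have : σ (cB b) = e ⟨cB b, hbQ⟩ :=
      (hg _ (Finset.mem_insert_of_mem hbQ)).trans (hfQ _ hbQ)
    rw [this]
    exact heP _
  let c : V → Fin (n + 1) := fun x => if x ∈ A then cA x else σ (cB x)
  have hcA : ∀ x ∈ A, c x = cA x := fun x hx => if_pos hx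
  have hcB : ∀ x ∈ B, c x = σ (cB x) := by
    intro x hx
    by_cases hxA : x ∈ A
    · rw [hcA x hxA, hAB x hxA hx, hσw]
    · exact if_neg hxA
  have hmix : ∀ x ∈ A, ∀ y ∈ B, y ∉ A → (x = w ∨ G.Adj w x) → (y = w ∨ G.Adj w y) →
      c x ≠ c y := by
    intro x hx y hy hyA hwx hwy h
    rw [hcA x hx, hcB y hy] at h
    have hwy' : G.Adj w y := hwy.resolve_left fun h => hyA (h ▸ hwA)
    refine hσQ y (mem_nb.2 ⟨hy, hwy'⟩) (h ▸ Finset.mem_image_of_mem _ ?_)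
    rcases hwx with rfl | hwx
    · exact Finset.mem_insert_self _ _
    · exact Finset.mem_insert_of_mem (mem_nb.2 ⟨hx, hwx⟩)
  have inA : ∀ z ∈ A, z ≠ w → ∀ x ∈ A ∪ B, (x = z ∨ G.Adj z x) → x ∈ A := by
    rintro z hz hzw x hx (rfl | hzx)
    · exact hz
    · rcases Finset.mem_union.1 hx with hx | hx
      · exact hx
      · by_cases hxw : x = w
        · exact hxw ▸ hwA
        · exact absurd hzx (hno z hz hzw x hx hxw)
  have inB : ∀ z ∈ B, z ≠ w → ∀ x ∈ A ∪ B, (x = z ∨ G.Adj z x) → x ∈ B := by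
    rintro z hz hzw x hx (rfl | hzx)
    · exact hz
    · rcases Finset.mem_union.1 hx with hx | hx
      · by_cases hxw : x = w
        · exact hxw ▸ hwB
        · exact absurd hzx.symm (hno x hx hxw z hz hzw)
      · exact hx
  refine ⟨c, fun z hz x hx y hy hxy hzx hzy => ?_⟩
  have bothA : z ∈ A → x ∈ A → y ∈ A → c x ≠ c y := by
    intro hz hx hy
    rw [hcA x hx, hcA y hy]
    exact hA z hz x hx y hy hxy hzx hzy
  have bothB : z ∈ B → x ∈ B → y ∈ B → c x ≠ c y := by
    intro hz hx hy h
    rw [hcB x hx, hcB y hy] at h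
    exact hB z hz x hx y hy hxy hzx hzy (hσ h)
  by_cases hzw : z = w
  · subst hzw
    by_cases hxA : x ∈ A <;> by_cases hyA : y ∈ A
    · exact bothA hwA hxA hyA
    · exact hmix x hxA y ((Finset.mem_union.1 hy).resolve_left hyA) hyA hzx hzy
    · exact (hmix y hyA x ((Finset.mem_union.1 hx).resolve_left hxA) hxA hzy hzx).symm
    · exact bothB hwB ((Finset.mem_union.1 hx).resolve_left hxA)
        ((Finset.mem_union.1 hy).resolve_left hyA)
  · rcases Finset.mem_union.1 hz with hz | hz
    · exact bothA hz (inA z hz hzw x hx hzx) (inA z hz hzw y hy hzy)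
    · exact bothB hz (inB z hz hzw x hx hzx) (inB z hz hzw y hy hzy)

/-- `T` is the union of two proper subsets that share one vertex and have no other edges between
them. -/
def Separable (G : SimpleGraph V) (T : Finset V) : Prop :=
  ∃ (w : V) (A B : Finset V), A ∪ B = T ∧ A ≠ T ∧ B ≠ T ∧ w ∈ A ∧ w ∈ B ∧
    (∀ a ∈ A, a ∈ B → a = w) ∧ ∀ a ∈ A, a ≠ w → ∀ b ∈ B, b ≠ w → ¬ G.Adj a b

/-- The neighbourhood of every vertex of a nonseparable chordal graph is connected. -/
theorem IsGood.reachable_nb (hG : IsGood G) {T : Finset V} (hT : ¬ Separable G T) {w x y : V}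
    (hw : w ∈ T) (hx : x ∈ nb G T w) (hy : y ∈ nb G T w) :
    (inside G (nb G T w : Set V)).Reachable x y := by
  classical
  rw [mem_nb] at hx hy
  set S : Set V := {z | z ∈ T ∧ z ≠ w} with hS
  -- Otherwise the component of `x` in `T` without `w`, and the remainder, each completed by `w`,
  -- would separate `T`.
  have hxy : (inside G S).Reachable x y := by
    by_contra hcon
    apply hT
    let B := T.filter fun z => z = w ∨ (inside G S).Reachable x z
    let A := T.filter fun z => z = w ∨ ¬ (inside G S).Reachable x z
    refine ⟨w, A, B, ?_, ?_, ?_, ?_, ?_, ?_, ?_⟩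
    · ext z
      simp only [A, B, Finset.mem_union, Finset.mem_filter]
      tauto
    · intro h
      have : x ∈ A := h ▸ hx.1
      rcases (Finset.mem_filter.1 this).2 with h | h
      · exact hx.2.ne' h
      · exact h (.refl _)
    · intro h
      have : y ∈ B := h ▸ hy.1
      rcases (Finset.mem_filter.1 this).2 with h | h
      · exact hy.2.ne' h
      · exact hcon h
    · exact Finset.mem_filter.2 ⟨hw, Or.inl rfl⟩
    · exact Finset.mem_filter.2 ⟨hw, Or.inl rfl⟩
    · intro a ha hb
      rcases (Finset.mem_filter.1 ha).2 with h | h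
      · exact h
      · exact (Finset.mem_filter.1 hb).2.resolve_right h
    · intro a ha haw b hb hbw hab
      have h1 := (Finset.mem_filter.1 ha).2.resolve_left haw
      have h2 := (Finset.mem_filter.1 hb).2.resolve_left hbw
      have hba : (inside G S).Adj b a :=
        ⟨hab.symm, ⟨(Finset.mem_filter.1 hb).1, hbw⟩, ⟨(Finset.mem_filter.1 ha).1, haw⟩⟩
      exact h1 (h2.trans hba.reachable)
  refine (hG.chordal.reachable_inter_neighbors (S := S) (by simp [hS]) ⟨hx.1, hx.2.ne'⟩ hx.2 hy.2
    hxy).mono (inside_mono ?_)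
  rintro z ⟨hz, hwz⟩
  exact Finset.mem_coe.2 (mem_nb.2 ⟨hz.1, hwz⟩)

/-- Colour an ear last. -/
theorem Rainbow.extend_ear {n : ℕ} {T : Finset V} {v u t : V} (hv : IsSimplicialIn G T v)
    (hnb : nb G T v = {u, t}) (hut : u ≠ t) (hcard : ((nb G T u ∪ nb G T t).erase v).card ≤ n)
    {c : V → Fin (n + 1)} (hc : Rainbow G (T.erase v) c) :
    ∃ c : V → Fin (n + 1), Rainbow G T c := by
  have hu : u ∈ nb G T v := by simp [hnb]
  have ht : t ∈ nb G T v := by simp [hnb]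
  rw [mem_nb] at hu ht
  have hadj := hv u hu.1 t ht.1 hu.2 ht.2 hut
  refine Rainbow.extend hv _ (fun x hx hxv h => ?_) hcard hc
  rw [Finset.mem_erase, Finset.mem_union, mem_nb, mem_nb]
  refine ⟨hxv, ?_⟩
  rcases h with h | ⟨z, hz, hvz, hzx⟩
  · have : x ∈ nb G T v := mem_nb.2 ⟨hx, h⟩
    rw [hnb, Finset.mem_insert, Finset.mem_singleton] at this
    rcases this with rfl | rfl
    · exact Or.inr ⟨hx, hadj.symm⟩
    · exact Or.inl ⟨hx, hadj⟩
  · have : z ∈ nb G T v := mem_nb.2 ⟨hz, hvz⟩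
    rw [hnb, Finset.mem_insert, Finset.mem_singleton] at this
    rcases this with rfl | rfl
    · exact Or.inl ⟨hx, hzx⟩
    · exact Or.inr ⟨hx, hzx⟩

/-- Induction principle: only nonseparable sets in which simplicial vertices have degree two need
to be coloured. -/
theorem IsGood.exists_rainbow (hG : IsGood G) {n : ℕ} (hdeg : ∀ T w, (nb G T w).card ≤ n)
    (step : ∀ T : Finset V, T.Nonempty → ¬ Separable G T →
      (∀ v ∈ T, IsSimplicialIn G T v → (nb G T v).card = 2) →
      (∀ S, S ⊂ T → ∃ c : V → Fin (n + 1), Rainbow G S c) →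
      ∃ c : V → Fin (n + 1), Rainbow G T c) (T : Finset V) :
    ∃ c : V → Fin (n + 1), Rainbow G T c := by
  induction T using Finset.strongInduction with
  | H T ih =>
  rcases T.eq_empty_or_nonempty with rfl | hne
  · exact ⟨fun _ => 0, fun w hw => absurd hw (Finset.notMem_empty w)⟩
  by_cases hsep : Separable G T
  · obtain ⟨w, A, B, rfl, hA, hB, hwA, hwB, hAB, hno⟩ := hsep
    obtain ⟨cA, hcA⟩ := ih A (Finset.subset_union_left.ssubset_of_ne hA)
    obtain ⟨cB, hcB⟩ := ih B (Finset.subset_union_right.ssubset_of_ne hB)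
    exact Rainbow.glue hwA hwB hAB hno (hdeg _ w) hcA hcB
  by_cases hs : ∀ v ∈ T, IsSimplicialIn G T v → (nb G T v).card = 2
  · exact step T hne hsep hs ih
  push Not at hs
  obtain ⟨v, hv, hvs, hcard⟩ := hs
  obtain ⟨c, hc⟩ := ih _ (Finset.erase_ssubset hv)
  have hle := hG.card_nb_le_two hvs
  rcases Nat.eq_zero_or_pos (nb G T v).card with h0 | hpos
  · rw [Finset.card_eq_zero] at h0
    refine Rainbow.extend hvs ∅ (fun x hx hxv h => ?_) (by simp) hc
    exfalso
    have hnone : ∀ z ∈ T, ¬ G.Adj v z := fun z hz hvz => by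
      have : z ∈ nb G T v := mem_nb.2 ⟨hz, hvz⟩
      simp [h0] at this
    rcases h with h | ⟨z, hz, hvz, -⟩
    · exact hnone x hx h
    · exact hnone z hz hvz
  · obtain ⟨u, hu⟩ := Finset.card_eq_one.1 (show (nb G T v).card = 1 by omega)
    have huv : u ∈ nb G T v := by simp [hu]
    rw [mem_nb] at huv
    have honly : ∀ z ∈ T, G.Adj v z → z = u := fun z hz hvz => by
      have : z ∈ nb G T v := mem_nb.2 ⟨hz, hvz⟩
      simpa [hu] using this
    -- For a pendant vertex `v` at `u`, the vertices to avoid are `u` and its other neighbours, as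
    -- many as the degree of `u`.
    refine Rainbow.extend hvs (insert u ((nb G T u).erase v)) (fun x hx hxv h => ?_) ?_ hc
    · rw [Finset.mem_insert, Finset.mem_erase, mem_nb]
      rcases h with h | ⟨z, hz, hvz, hzx⟩
      · exact Or.inl (honly x hx h)
      · rw [honly z hz hvz] at hzx
        exact Or.inr ⟨hxv, hx, hzx⟩
    · refine (Finset.card_insert_le _ _).trans ?_
      have hmem : v ∈ nb G T u := mem_nb.2 ⟨hv, huv.2.symm⟩
      rw [Finset.card_erase_add_one hmem]
      exact hdeg T u

end Rainbow

/-! ### Developing a chordal outerplanar graph into a triangulation by a complete graph -/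

section Model

/-- A rotation system on the complete graph with `n + 1` vertices: `pos w a` is the position of `a`
in the cyclic order around `w`. -/
abbrev Rotation (n : ℕ) : Type := Fin (n + 1) → Fin (n + 1) → ZMod n

/-- `a`, `b`, `c` span a triangle at `a`: `b` and `c` are consecutive around `a`. -/
def Rotation.Face {n : ℕ} (pos : Rotation n) (a b c : Fin (n + 1)) : Prop :=
  a ≠ b ∧ a ≠ c ∧ b ≠ c ∧ (pos a b - pos a c = 1 ∨ pos a b - pos a c = -1)

instance {n : ℕ} (pos : Rotation n) (a b c : Fin (n + 1)) : Decidable (pos.Face a b c) :=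
  inferInstanceAs (Decidable (_ ∧ _ ∧ _ ∧ _))

/-- The rotation system comes from a triangulation of a closed surface in which any two vertices
are adjacent. -/
structure Rotation.IsTriangulation {n : ℕ} (pos : Rotation n) : Prop where
  pos_dim : 0 < n
  inj : ∀ w a b, a ≠ w → b ≠ w → pos w a = pos w b → a = b
  swap : ∀ a b c, pos.Face a b c → pos.Face b a c
  exists_face : ∀ a b x, a ≠ b → ∃ c, c ≠ x ∧ pos.Face a b c

theorem Rotation.Face.symm {n : ℕ} {pos : Rotation n} {a b c : Fin (n + 1)}
    (h : pos.Face a b c) : pos.Face a c b := by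
  refine ⟨h.2.1, h.1, h.2.2.1.symm, ?_⟩
  rcases h.2.2.2 with h | h
  · exact Or.inr (by rw [← neg_sub, h])
  · exact Or.inl (by rw [← neg_sub, h, neg_neg])

/-- The triangulation of the projective plane by the complete graph on six vertices. -/
def projectiveRotation : Rotation 5 :=
  ![![0, 1, 3, 2, 4, 0], ![4, 0, 1, 3, 2, 0], ![2, 4, 0, 1, 3, 0], ![3, 2, 4, 0, 1, 0],
    ![1, 3, 2, 4, 0, 0], ![0, 1, 2, 3, 4, 0]]

/-- The triangulation of the torus by the complete graph on seven vertices. -/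
def torusRotation : Rotation 6 := fun w a => (![0, 0, 2, 1, 4, 5, 3] : Fin 7 → ZMod 6) (a - w)

-- The diagonal entries `pos w w` are fillers: neither `Face` nor `inj` looks at them.
set_option maxRecDepth 100000 in
theorem projectiveRotation_isTriangulation : projectiveRotation.IsTriangulation :=
  ⟨by decide, by decide, by decide, by decide⟩

set_option maxRecDepth 100000 in
theorem torusRotation_isTriangulation : torusRotation.IsTriangulation :=
  ⟨by decide, by decide, by decide, by decide⟩

end Model

/-! ### Unfolding a graph over a triangulated surface -/

section Develop

variable {V : Type*} {G : SimpleGraph V} {n : ℕ} {pos : Rotation n}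

/-- The colouring maps triangles to faces and triangles on the same edge to different faces. -/
structure Develops (G : SimpleGraph V) (pos : Rotation n) (T : Finset V) (c : V → Fin (n + 1)) :
    Prop where
  adj : ∀ x ∈ T, ∀ y ∈ T, G.Adj x y → c x ≠ c y
  face : ∀ x ∈ T, ∀ y ∈ T, ∀ z ∈ T, G.Adj x y → G.Adj x z → G.Adj y z → pos.Face (c x) (c y) (c z)
  ne : ∀ x ∈ T, ∀ y ∈ T, ∀ z ∈ T, ∀ z' ∈ T, G.Adj x y → G.Adj x z → G.Adj y z → G.Adj x z' →
    G.Adj y z' → z ≠ z' → c z ≠ c z'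

variable [DecidableEq V]

/-- A simplicial `v` has at most two neighbours, so it creates at most one new triangle, and `h2`
and `h3` concern only that one. -/
theorem Develops.extend (hpos : pos.IsTriangulation) (hG : IsGood G) {T : Finset V} {v : V}
    (hs : IsSimplicialIn G T v) {c : V → Fin (n + 1)} (hc : Develops G pos (T.erase v) c)
    (a : Fin (n + 1)) (h1 : ∀ u ∈ T, G.Adj v u → a ≠ c u)
    (h2 : ∀ u ∈ T, ∀ t ∈ T, G.Adj v u → G.Adj v t → G.Adj u t → pos.Face (c u) (c t) a)
    (h3 : ∀ u ∈ T, ∀ t ∈ T, ∀ x ∈ T, G.Adj v u → G.Adj v t → G.Adj u t → x ≠ v → G.Adj u x →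
      G.Adj t x → a ≠ c x) : Develops G pos T (Function.update c v a) := by
  have hold : ∀ {x}, x ≠ v → Function.update c v a x = c x :=
    fun h => Function.update_of_ne h _ _
  have hnew : Function.update c v a v = a := Function.update_self _ _ _
  have hmem : ∀ {x}, x ∈ T → x ≠ v → x ∈ T.erase v := fun hx hxv => Finset.mem_erase.2 ⟨hxv, hx⟩
  have hthree : ∀ {x y z}, x ∈ T → y ∈ T → z ∈ T → G.Adj v x → G.Adj v y → G.Adj v z →
      x ≠ y → x ≠ z → y ≠ z → False := by
    intro x y z hx hy hz hvx hvy hvz hxy hxz hyz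
    exact hG.not_clique hvx hvy hvz (hs x hx y hy hvx hvy hxy) (hs x hx z hz hvx hvz hxz)
      (hs y hy z hz hvy hvz hyz)
  constructor
  · intro x hx y hy hxy
    by_cases hxv : x = v
    · subst hxv
      rw [hnew, hold hxy.ne']
      exact h1 y hy hxy
    by_cases hyv : y = v
    · subst hyv
      rw [hnew, hold hxv]
      exact (h1 x hx hxy.symm).symm
    rw [hold hxv, hold hyv]
    exact hc.adj x (hmem hx hxv) y (hmem hy hyv) hxy
  · intro x hx y hy z hz hxy hxz hyz
    by_cases hxv : x = v
    · subst hxv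
      rw [hnew, hold hxy.ne', hold hxz.ne']
      exact hpos.swap _ _ _ (h2 y hy z hz hxy hxz hyz).symm
    by_cases hyv : y = v
    · subst hyv
      rw [hnew, hold hxy.ne, hold hyz.ne']
      exact (h2 x hx z hz hxy.symm hyz hxz).symm
    by_cases hzv : z = v
    · subst hzv
      rw [hnew, hold hxz.ne, hold hyz.ne]
      exact h2 x hx y hy hxz.symm hyz.symm hxy
    rw [hold hxv, hold hyv, hold hzv]
    exact hc.face x (hmem hx hxv) y (hmem hy hyv) z (hmem hz hzv) hxy hxz hyz
  · intro x hx y hy z hz z' hz' hxy hxz hyz hxz' hyz' hne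
    by_cases hxv : x = v
    · subst hxv
      exact (hthree hy hz hz' hxy hxz hxz' hyz.ne hyz'.ne hne).elim
    by_cases hyv : y = v
    · subst hyv
      exact (hthree hx hz hz' hxy.symm hyz hyz' hxz.ne hxz'.ne hne).elim
    by_cases hzv : z = v
    · subst hzv
      rw [hnew, hold hne.symm]
      exact h3 x hx y hy z' hz' hxz.symm hyz.symm hxy hne.symm hxz' hyz'
    by_cases hzv' : z' = v
    · subst hzv'
      rw [hnew, hold hne]
      exact (h3 x hx y hy z hz hxz'.symm hyz'.symm hxy hne hxz hyz).symm
    rw [hold hzv, hold hzv']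
    exact hc.ne x (hmem hx hxv) y (hmem hy hyv) z (hmem hz hzv) z' (hmem hz' hzv') hxy hxz hyz
      hxz' hyz' hne

theorem IsGood.exists_develops (hG : IsGood G) (hpos : pos.IsTriangulation) (T : Finset V) :
    ∃ c : V → Fin (n + 1), Develops G pos T c := by
  induction T using Finset.strongInduction with
  | H T ih =>
  rcases T.eq_empty_or_nonempty with rfl | hne
  · exact ⟨fun _ => 0, by simp, by simp, by simp⟩
  obtain ⟨v, hv, hs⟩ := hG.chordal.exists_isSimplicialIn hne
  obtain ⟨c, hc⟩ := ih _ (Finset.erase_ssubset hv)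
  by_cases hpair : ∃ u ∈ T, ∃ t ∈ T, G.Adj v u ∧ G.Adj v t ∧ u ≠ t
  · obtain ⟨u, hu, t, ht, hvu, hvt, hut⟩ := hpair
    have hadj := hs u hu t ht hvu hvt hut
    have hcut := hc.adj u (Finset.mem_erase.2 ⟨hvu.ne', hu⟩) t (Finset.mem_erase.2 ⟨hvt.ne', ht⟩)
      hadj
    have honly : ∀ z ∈ T, G.Adj v z → z = u ∨ z = t := by
      intro z hz hvz
      by_contra! h
      exact hG.not_clique hvu hvt hvz hadj (hs u hu z hz hvu hvz h.1.symm)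
        (hs t ht z hz hvt hvz h.2.symm)
    obtain ⟨a, ha, hface⟩ : ∃ a, (∀ x ∈ T, x ≠ v → G.Adj u x → G.Adj t x → a ≠ c x) ∧
        pos.Face (c u) (c t) a := by
      -- The edge `ut` carries at most one other triangle, by `not_book`; `exists_face` gives a face
      -- on its image avoiding the apex colour already used.
      by_cases hx : ∃ x ∈ T, x ≠ v ∧ G.Adj u x ∧ G.Adj t x
      · obtain ⟨x, hx, hxv, hux, htx⟩ := hx
        obtain ⟨a, ha, hface⟩ := hpos.exists_face (c u) (c t) (c x) hcut
        refine ⟨a, fun y hy hyv huy hty => ?_, hface⟩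
        by_cases hxy : x = y
        · exact hxy ▸ ha
        · exact (hG.not_book hadj hux htx huy hty hvu.symm hvt.symm hxy hxv hyv).elim
      · obtain ⟨a, -, hface⟩ := hpos.exists_face (c u) (c t) 0 hcut
        exact ⟨a, fun y hy hyv huy hty => absurd ⟨y, hy, hyv, huy, hty⟩ hx, hface⟩
    refine ⟨_, hc.extend hpos hG hs a ?_ ?_ ?_⟩
    · intro z hz hvz
      rcases honly z hz hvz with rfl | rfl
      · exact hface.2.1.symm
      · exact hface.2.2.1.symm
    · intro y hy z hz hvy hvz hyz
      rcases honly y hy hvy with rfl | rfl <;> rcases honly z hz hvz with rfl | rfl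
      · exact absurd rfl hyz.ne
      · exact hface
      · exact hpos.swap _ _ _ hface
      · exact absurd rfl hyz.ne
    · intro y hy z hz x hx hvy hvz hyz hxv hyx hzx
      rcases honly y hy hvy with rfl | rfl <;> rcases honly z hz hvz with rfl | rfl
      · exact absurd rfl hyz.ne
      · exact ha x hx hxv hyx hzx
      · exact ha x hx hxv hzx hyx
      · exact absurd rfl hyz.ne
  · push Not at hpair
    obtain ⟨a, ha⟩ : ∃ a, ∀ u ∈ T, G.Adj v u → a ≠ c u := by
      by_cases hu : ∃ u ∈ T, G.Adj v u
      · obtain ⟨u, hu, hvu⟩ := hu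
        have : Nontrivial (Fin (n + 1)) :=
          Fin.nontrivial_iff_two_le.2 (Nat.succ_le_succ hpos.pos_dim)
        obtain ⟨a, ha⟩ := exists_ne (c u)
        exact ⟨a, fun t ht hvt => hpair u hu t ht hvu hvt ▸ ha⟩
      · exact ⟨0, fun u hu' hvu => absurd ⟨u, hu', hvu⟩ hu⟩
    exact ⟨_, hc.extend hpos hG hs a ha
      (fun u hu t ht hvu hvt hut => absurd (hpair u hu t ht hvu hvt) hut.ne)
      (fun u hu t ht _ _ hvu hvt hut => absurd (hpair u hu t ht hvu hvt) hut.ne)⟩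

/-- Join two neighbours of `w` by a path inside its neighbourhood. Its colours move around `c w` one
position at a time without reversing, and fewer than `n` steps cannot close a cycle of length `n`.
-/
theorem Develops.rainbow (hpos : pos.IsTriangulation) (hG : IsGood G) {T : Finset V}
    (hT : ¬ Separable G T) (hdeg : ∀ w, (nb G T w).card ≤ n) {c : V → Fin (n + 1)}
    (hc : Develops G pos T c) : Rainbow G T c := by
  intro w hw x hx y hy hxy hwx hwy
  by_cases hxw : x = w
  · subst hxw
    exact hc.adj _ hx _ hy (hwy.resolve_left hxy.symm)
  by_cases hyw : y = w
  · subst hyw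
    exact (hc.adj _ hy _ hx (hwx.resolve_left hxy)).symm
  obtain ⟨k, p, rfl, rfl, hadj, hinj, -, -⟩ := exists_geodesic (hG.reachable_nb hT hw
    (mem_nb.2 ⟨hx, hwx.resolve_left hxw⟩) (mem_nb.2 ⟨hy, hwy.resolve_left hyw⟩))
  have hk : 0 < k := Nat.pos_of_ne_zero fun h => hxy (by rw [h])
  have hpadj : ∀ i < k, G.Adj (p i) (p (i + 1)) := fun i hi => (hadj i hi).1
  have hpnb : ∀ i ≤ k, p i ∈ T ∧ G.Adj w (p i) := by
    intro i hi
    rcases hi.lt_or_eq with hlt | rfl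
    · exact mem_nb.1 (Finset.mem_coe.1 (hadj i hlt).2.1)
    · exact ⟨hy, hwy.resolve_left hyw⟩
  have hkn : k + 1 ≤ n := by
    have hsub : (Finset.range (k + 1)).image p ⊆ nb G T w := by
      intro z hz
      obtain ⟨i, hi, rfl⟩ := Finset.mem_image.1 hz
      exact mem_nb.2 (hpnb i (Nat.lt_succ_iff.1 (Finset.mem_range.1 hi)))
    have hcard := (Finset.card_le_card hsub).trans (hdeg w)
    rwa [Finset.card_image_of_injOn, Finset.card_range] at hcard
    intro i hi j hj hij
    simp only [Finset.coe_range, Set.mem_Iio, Nat.lt_succ_iff] at hi hj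
    rcases le_total i j with h | h
    · exact hinj i j h hj hij
    · exact (hinj j i h hi hij.symm).symm
  set q : ℕ → ZMod n := fun i => pos (c w) (c (p i))
  have hstep : ∀ i < k, q (i + 1) - q i = 1 ∨ q (i + 1) - q i = -1 := fun i hi =>
    (hc.face w hw _ (hpnb (i + 1) hi).1 _ (hpnb i hi.le).1 (hpnb _ hi).2 (hpnb i hi.le).2
      (hpadj i hi).symm).2.2.2
  -- `p i` and `p (i + 2)` are apexes of two triangles on the edge from `w` to `p (i + 1)`, so `ne`
  -- separates their colours.
  have hturn : ∀ i, i + 2 ≤ k → q (i + 2) ≠ q i := by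
    intro i hi h
    have h0 := hpnb i (by omega)
    have h1 := hpnb (i + 1) (by omega)
    have h2 := hpnb (i + 2) hi
    refine hc.ne w hw _ h1.1 _ h2.1 _ h0.1 h1.2 h2.2 (hpadj (i + 1) (by omega)) h0.2
      (hpadj i (by omega)).symm (fun h => ?_) (hpos.inj _ _ _ ?_ ?_ h)
    · have := hinj i (i + 2) (by omega) hi h.symm
      omega
    · exact (hc.adj _ hw _ h2.1 h2.2).symm
    · exact (hc.adj _ hw _ h0.1 h0.2).symm
  obtain ⟨ε, hε, hε0⟩ : ∃ ε : ZMod n, (ε = 1 ∨ ε = -1) ∧ q 1 - q 0 = ε := ⟨_, hstep 0 hk, rfl⟩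
  have hconst : ∀ i < k, q (i + 1) - q i = ε := by
    intro i
    induction i with
    | zero => exact fun _ => hε0
    | succ i ih =>
      intro hi
      have h1 := ih (by omega)
      have h2 := hstep (i + 1) hi
      have h3 := hturn i (by omega)
      by_contra hcon
      apply h3
      rcases hε with rfl | rfl <;> rcases h2 with h2 | h2
      · exact absurd h2 hcon
      · linear_combination h1 + h2
      · linear_combination h1 + h2
      · exact absurd h2 hcon
  have hlin : ∀ i ≤ k, q i = q 0 + i * ε := by
    intro i
    induction i with
    | zero => intro _; simp
    | succ i ih =>
      intro hi
      have h1 := hconst i hi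
      have h2 := ih (by omega)
      push_cast
      linear_combination h1 + h2
  intro hcol
  have h0 : (k : ZMod n) * ε = 0 := by
    have h1 := hlin k le_rfl
    have h2 : q k = q 0 := by simp only [q, hcol]
    linear_combination h2 - h1
  have hk0 : (k : ZMod n) = 0 := by
    rcases hε with rfl | rfl
    · simpa using h0
    · simpa using h0
  rw [ZMod.natCast_eq_zero_iff] at hk0
  exact absurd (Nat.le_of_dvd hk hk0) (by omega)

end Develop

/-! ### Colouring greedily from an ear -/

section Greedy

variable {V : Type*} {G : SimpleGraph V}

theorem mem_of_reachable {H : SimpleGraph V} {a b : V} (h : H.Reachable a b) (C : Set V)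
    (hC : ∀ x ∈ C, ∀ y, H.Adj x y → y ∈ C) (ha : a ∈ C) : b ∈ C := by
  obtain ⟨q⟩ := h
  induction q with
  | nil => exact ha
  | cons hadj _ ih => exact ih (hC _ ha _ hadj)

theorem isContained_F₄ {u t x a b v : V} (hut : G.Adj u t) (hux : G.Adj u x) (htx : G.Adj t x)
    (hvu : G.Adj u v) (hvt : G.Adj t v) (hau : G.Adj u a) (hax : G.Adj x a) (hbt : G.Adj t b)
    (hbx : G.Adj x b) (hvx : v ≠ x) (hat : a ≠ t) (hbu : b ≠ u) (hab : a ≠ b) (hav : a ≠ v)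
    (hbv : b ≠ v) : F₄.IsContained G := by
  -- Each ear is listed at the index of the triangle vertex it misses: `b` misses `u`, `a` misses
  -- `t`, `v` misses `x`.
  refine ⟨⟨⟨Sum.elim ![u, t, x] ![b, a, v], ?_⟩, ?_⟩⟩
  · intro i j hij
    have := hut.symm
    have := hux.symm
    have := htx.symm
    have := hvu.symm
    have := hvt.symm
    have := hau.symm
    have := hax.symm
    have := hbt.symm
    have := hbx.symm
    rw [F₄, SimpleGraph.fromRel_adj] at hij
    rcases i with i | i <;> rcases j with j | j <;> fin_cases i <;> fin_cases j <;>
      simp_all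
  · intro i j hij
    have := hut.ne
    have := hux.ne
    have := htx.ne
    have := hvu.ne
    have := hvt.ne
    have := hau.ne
    have := hax.ne
    have := hbt.ne
    have := hbx.ne
    change Sum.elim ![u, t, x] ![b, a, v] i = Sum.elim ![u, t, x] ![b, a, v] j at hij
    rcases i with i | i <;> rcases j with j | j <;> fin_cases i <;> fin_cases j <;>
      simp_all

variable [DecidableEq V]

/-- Among the neighbours of `u`, the ear `v` sees only `t`. If `t` saw only `v` there, then `{v, t}`
would be a component of a connected neighbourhood with more than two vertices. -/
theorem IsGood.exists_second_common (hG : IsGood G) {T : Finset V} (hT : ¬ Separable G T)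
    {v u t : V} (hnb : nb G T v = {u, t}) (hut : u ≠ t) (huT : u ∈ T) (hv : v ∈ nb G T u)
    (h3 : 2 < (nb G T u).card) : ∃ x ∈ T, x ≠ v ∧ G.Adj u x ∧ G.Adj t x := by
  obtain ⟨z, hz, hz'⟩ : ∃ z ∈ nb G T u, z ∉ ({v, t} : Finset V) :=
    Finset.exists_mem_notMem_of_card_lt_card (lt_of_le_of_lt Finset.card_le_two h3)
  by_contra! hcon
  have hr := hG.reachable_nb hT huT hv hz
  have := mem_of_reachable hr {v, t} ?_ (by simp)
  · simp only [Finset.mem_insert, Finset.mem_singleton] at hz'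
    exact hz' this
  · rintro x (rfl | rfl) y hxy
    · have hy := mem_nb.1 (Finset.mem_coe.1 hxy.2.2)
      have : y ∈ nb G T x := mem_nb.2 ⟨hy.1, hxy.1⟩
      rw [hnb, Finset.mem_insert, Finset.mem_singleton] at this
      rcases this with rfl | rfl
      · exact absurd rfl hy.2.ne
      · simp
    · have hy := mem_nb.1 (Finset.mem_coe.1 hxy.2.2)
      by_cases hyv : y = v
      · simp [hyv]
      · exact absurd hxy.1 (hcon y hy.1 hyv hy.2)

/-- If `u` has a third neighbour, `u` and `t` share both `v` and a second vertex, so the union loses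
two; erasing `v` loses one more, which accounts for the `3`. If `u` has degree at most two, it
contributes at most one vertex besides `v`, and `t` at most `n - 1`. -/
theorem IsGood.card_ear_le (hG : IsGood G) {T : Finset V} (hT : ¬ Separable G T) {n : ℕ}
    (hdeg : ∀ w, (nb G T w).card ≤ n) {v u t : V} (hvT : v ∈ T) (hnb : nb G T v = {u, t})
    (hut : u ≠ t) (hsum : (nb G T u).card + (nb G T t).card ≤ n + 3) :
    ((nb G T u ∪ nb G T t).erase v).card ≤ n := by
  have hu : u ∈ nb G T v := by simp [hnb]
  have ht : t ∈ nb G T v := by simp [hnb]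
  rw [mem_nb] at hu ht
  have hvu : v ∈ nb G T u := mem_nb.2 ⟨hvT, hu.2.symm⟩
  have hvt : v ∈ nb G T t := mem_nb.2 ⟨hvT, ht.2.symm⟩
  by_cases h3 : 2 < (nb G T u).card
  · obtain ⟨x, hx, hxv, hux, htx⟩ := hG.exists_second_common hT hnb hut hu.1 hvu h3
    have hsub : ({v, x} : Finset V) ⊆ nb G T u ∩ nb G T t := by
      intro z hz
      rw [Finset.mem_insert, Finset.mem_singleton] at hz
      rcases hz with rfl | rfl
      · exact Finset.mem_inter.2 ⟨hvu, hvt⟩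
      · exact Finset.mem_inter.2 ⟨mem_nb.2 ⟨hx, hux⟩, mem_nb.2 ⟨hx, htx⟩⟩
    have h2 := Finset.card_le_card hsub
    rw [Finset.card_pair hxv.symm] at h2
    have h1 := Finset.card_union_add_card_inter (nb G T u) (nb G T t)
    rw [Finset.card_erase_of_mem (Finset.mem_union_left _ hvu)]
    omega
  · have h1 : ((nb G T u).erase v).card ≤ 1 := by
      rw [Finset.card_erase_of_mem hvu]; omega
    have h2 : ((nb G T t).erase v).card + 1 ≤ n := by
      rw [Finset.card_erase_add_one hvt]; exact hdeg t
    rw [Finset.erase_union_distrib]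
    exact (Finset.card_union_le _ _).trans (by omega)

theorem exists_pair_of_card_nb {T : Finset V} {v : V} (hs : IsSimplicialIn G T v)
    (h : (nb G T v).card = 2) :
    ∃ u t, nb G T v = {u, t} ∧ u ≠ t ∧ u ∈ T ∧ t ∈ T ∧ G.Adj v u ∧ G.Adj v t ∧ G.Adj u t := by
  obtain ⟨u, t, hut, hnb⟩ := Finset.card_eq_two.1 h
  have hu : u ∈ nb G T v := by simp [hnb]
  have ht : t ∈ nb G T v := by simp [hnb]
  rw [mem_nb] at hu ht
  exact ⟨u, t, hnb, hut, hu.1, ht.1, hu.2, ht.2, hs u hu.1 t ht.1 hu.2 ht.2 hut⟩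

/-- Here every ear is light enough. This serves `m = n ≤ 3` and also `m = 4`, `n = 5`, where one
spare colour is available. -/
theorem IsGood.exists_rainbow_of_two_mul_le (hG : IsGood G) {m n : ℕ} (hmn : m ≤ n)
    (h2 : 2 * m ≤ n + 3) (hdeg : ∀ T w, (nb G T w).card ≤ m) (T : Finset V) :
    ∃ c : V → Fin (n + 1), Rainbow G T c := by
  refine hG.exists_rainbow (fun T w => (hdeg T w).trans hmn) (fun T hne hT hsim ih => ?_) T
  obtain ⟨v, hv, hs⟩ := hG.chordal.exists_isSimplicialIn hne
  obtain ⟨u, t, hnb, hut, -⟩ := exists_pair_of_card_nb hs (hsim v hv hs)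
  obtain ⟨c, hc⟩ := ih _ (Finset.erase_ssubset hv)
  have hu := hdeg T u
  have ht := hdeg T t
  exact hc.extend_ear hs hnb hut (hG.card_ear_le hT (fun w => (hdeg T w).trans hmn) hv hnb hut
    (by omega))

/-- The third edge at `u` of the triangle `u t x` next to the ear `v` also carries an ear. -/
theorem IsGood.exists_outer_ear (hG : IsGood G) {T : Finset V} (hT : ¬ Separable G T)
    {v u t x : V} (hvT : v ∈ T) (hnb : nb G T v = {u, t}) (huT : u ∈ T) (htT : t ∈ T)
    (hxT : x ∈ T) (hvu : G.Adj v u) (hvt : G.Adj v t) (hut : G.Adj u t) (hux : G.Adj u x)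
    (htx : G.Adj t x) (hxv : x ≠ v) (h4 : (nb G T u).card = 4) :
    ∃ a, G.Adj u a ∧ G.Adj x a ∧ a ≠ v ∧ a ≠ t ∧ ¬ G.Adj t a := by
  obtain ⟨a, ha, ha'⟩ : ∃ a ∈ nb G T u, a ∉ ({v, t, x} : Finset V) :=
    Finset.exists_mem_notMem_of_card_lt_card (lt_of_le_of_lt Finset.card_le_three (by omega))
  simp only [Finset.mem_insert, Finset.mem_singleton, not_or] at ha'
  obtain ⟨hav, hat, hax⟩ := ha'
  have hua := (mem_nb.1 ha).2
  have hta : ¬ G.Adj t a := fun h =>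
    hG.not_book hut hvu.symm hvt.symm hux htx hua h hxv.symm (Ne.symm hav) (Ne.symm hax)
  have hvnb : v ∈ nb G T u := mem_nb.2 ⟨hvT, hvu.symm⟩
  have hall : nb G T u = {v, t, x, a} := by
    symm
    apply Finset.eq_of_subset_of_card_le
    · intro z hz
      simp only [Finset.mem_insert, Finset.mem_singleton] at hz
      rcases hz with rfl | rfl | rfl | rfl
      · exact hvnb
      · exact mem_nb.2 ⟨htT, hut⟩
      · exact mem_nb.2 ⟨hxT, hux⟩
      · exact ha
    · rw [h4, Finset.card_insert_of_notMem, Finset.card_insert_of_notMem, Finset.card_pair]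
      · exact Ne.symm hax
      · simp [htx.ne, Ne.symm hat]
      · simp [hvt.ne, hxv.symm, Ne.symm hav]
  refine ⟨a, hua, ?_, hav, hat, hta⟩
  -- The vertex `a` sees neither `v` nor `t`, so without `x` it would be isolated in the connected
  -- neighbourhood of `u`.
  by_contra hxa
  have := mem_of_reachable (hG.reachable_nb hT huT hvnb ha) {v, t, x} ?_ (by simp)
  · rcases this with h | h | h
    · exact hav h
    · exact hat h
    · exact hax h
  · intro z hz y hzy
    have hy : y ∈ nb G T u := hzy.2.2
    have hyT := (mem_nb.1 hy).1
    rw [hall] at hy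
    simp only [Finset.mem_insert, Finset.mem_singleton] at hy
    rcases hy with rfl | rfl | rfl | rfl
    · simp
    · simp
    · simp
    · exfalso
      rcases hz with rfl | rfl | rfl
      · have : y ∈ nb G T z := mem_nb.2 ⟨hyT, hzy.1⟩
        rw [hnb, Finset.mem_insert, Finset.mem_singleton] at this
        rcases this with h | h
        · exact hua.ne h.symm
        · exact hat h
      · exact hta hzy.1
      · exact hxa hzy.1

/-- An ear too heavy to be coloured last has both base vertices of degree four; the two further
sides of the triangle behind it then carry ears too, which gives `F₄`. -/
theorem IsGood.exists_rainbow_of_F₄_free (hG : IsGood G) (hF : ¬ F₄.IsContained G)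
    (hdeg : ∀ T w, (nb G T w).card ≤ 4) (T : Finset V) :
    ∃ c : V → Fin (4 + 1), Rainbow G T c := by
  refine hG.exists_rainbow hdeg (fun T hne hT hsim ih => ?_) T
  obtain ⟨v, hv, hs⟩ := hG.chordal.exists_isSimplicialIn hne
  obtain ⟨u, t, hnb, hut, huT, htT, hvu, hvt, hadj⟩ := exists_pair_of_card_nb hs (hsim v hv hs)
  obtain ⟨c, hc⟩ := ih _ (Finset.erase_ssubset hv)
  have hu := hdeg T u
  have ht := hdeg T t
  refine hc.extend_ear hs hnb hut (hG.card_ear_le hT (hdeg T) hv hnb hut ?_)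
  by_contra! hsum
  have hu4 : (nb G T u).card = 4 := by omega
  have ht4 : (nb G T t).card = 4 := by omega
  obtain ⟨x, hx, hxv, hux, htx⟩ := hG.exists_second_common hT hnb hut huT
    (mem_nb.2 ⟨hv, hvu.symm⟩) (by omega)
  obtain ⟨a, hua, hxa, hav, hat, hta⟩ := hG.exists_outer_ear hT hv hnb huT htT hx hvu hvt hadj
    hux htx hxv hu4
  obtain ⟨b, htb, hxb, hbv, hbu, hub⟩ := hG.exists_outer_ear hT hv
    (hnb.trans (Finset.pair_comm u t)) htT huT hx hvt hvu hadj.symm htx hux hxv ht4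
  exact hF (isContained_F₄ hadj hux htx hvu.symm hvt.symm hua hxa htb hxb hxv.symm hat hbu
    (fun h => hta (h ▸ htb)) hav hbv)

end Greedy

/-! ### Ears at vertices of small degree -/

section Ears

variable {V : Type*} {G : SimpleGraph V}

/-- A vertex with at most one neighbour. -/
def IsLeaf (H : SimpleGraph V) (x : V) : Prop := ∀ a b, H.Adj x a → H.Adj x b → a = b

/-- With degrees at most two, the geodesic from one leaf to another absorbs its whole component, and
its inner vertices have two neighbours. -/
theorem not_three_leaves {H : SimpleGraph V} (hdeg : ∀ y a b c, H.Adj y a → H.Adj y b →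
      H.Adj y c → a = b ∨ a = c ∨ b = c) {x y z : V} (hxy : H.Reachable x y)
    (hxz : H.Reachable x z) (hx : IsLeaf H x) (hy : IsLeaf H y) (hz : IsLeaf H z) (hne : x ≠ y)
    (hne' : x ≠ z) (hne'' : y ≠ z) : False := by
  obtain ⟨k, p, rfl, rfl, hadj, hinj, -, -⟩ := exists_geodesic hxy
  have hk : 0 < k := Nat.pos_of_ne_zero fun h => hne (by rw [h])
  have hback : ∀ i, 0 < i → i ≤ k → H.Adj (p i) (p (i - 1)) := by
    intro i hi hik
    have := (hadj (i - 1) (by omega)).symm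
    rwa [Nat.sub_add_cancel hi] at this
  have hdist : ∀ i, 0 < i → i < k → p (i - 1) ≠ p (i + 1) := by
    intro i hi hik h
    have := hinj (i - 1) (i + 1) (by omega) (by omega) h
    omega
  obtain ⟨i, hi, rfl⟩ := mem_of_reachable hxz {a | ∃ i ≤ k, p i = a} (by
    rintro _ ⟨i, hi, rfl⟩ a ha
    rcases Nat.eq_zero_or_pos i with rfl | hi0
    · exact ⟨1, hk, hx _ _ (hadj 0 hk) ha⟩
    rcases hi.lt_or_eq with hlt | rfl
    · rcases hdeg _ _ _ _ (hback i hi0 hi) (hadj i hlt) ha with h | h | h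
      · exact absurd h (hdist i hi0 hlt)
      · exact ⟨i - 1, by omega, h⟩
      · exact ⟨i + 1, hlt, h⟩
    · exact ⟨i - 1, by omega, hy _ _ (hback i hi0 le_rfl) ha⟩) ⟨0, Nat.zero_le _, rfl⟩
  have hi0 : 0 < i := Nat.pos_of_ne_zero fun h => hne' (by rw [h])
  have hik : i < k := hi.lt_of_ne fun h => hne'' (by rw [h])
  exact hdist i hi0 hik (hz _ _ (hback i hi0 hi) (hadj i hik))

/-- Inner vertices of a geodesic are not leaves, so deleting leaves does not disconnect the others.
-/
theorem reachable_of_leaves {L L' : Set V} {x y : V} (hx : x ∈ L') (hy : y ∈ L')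
    (h : (inside G L).Reachable x y)
    (hleaf : ∀ z ∈ L, z ∉ L' → IsLeaf (inside G L) z) : (inside G L').Reachable x y := by
  obtain ⟨k, p, rfl, rfl, hadj, hinj, -, -⟩ := exists_geodesic h
  have hmem : ∀ i ≤ k, p i ∈ L' := by
    intro i hi
    rcases Nat.eq_zero_or_pos i with rfl | hi0
    · exact hx
    rcases hi.lt_or_eq with hlt | rfl
    · by_contra hcon
      have hb := (hadj (i - 1) (by omega)).symm
      rw [Nat.sub_add_cancel hi0] at hb
      have := hinj _ _ (by omega) (by omega) (hleaf _ hb.2.1 hcon _ _ hb (hadj i hlt))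
      omega
    · exact hy
  have : ∀ i ≤ k, (inside G L').Reachable (p 0) (p i) := by
    intro i
    induction i with
    | zero => exact fun _ => .refl _
    | succ i ih =>
      intro hi
      have ha : (inside G L').Adj (p i) (p (i + 1)) :=
        ⟨(hadj i hi).1, hmem i (by omega), hmem _ hi⟩
      exact (ih (by omega)).trans ha.reachable
  exact this k le_rfl

/-! ### Peeling off simplicial vertices -/

open scoped Classical in
/-- The vertices of `S` that are not simplicial in `S`. -/
noncomputable def core (G : SimpleGraph V) (S : Finset V) : Finset V :=
  S.filter fun v => ¬ IsSimplicialIn G S v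

theorem mem_core {S : Finset V} {v : V} : v ∈ core G S ↔ v ∈ S ∧ ¬ IsSimplicialIn G S v := by
  simp [core]

theorem core_subset (S : Finset V) : core G S ⊆ S := fun _ h => (mem_core.1 h).1

/-- All neighbourhoods in `S` are connected. -/
def LinkConnected (G : SimpleGraph V) (S : Finset V) : Prop :=
  ∀ w ∈ S, ∀ x ∈ nb G S w, ∀ y ∈ nb G S w, (inside G (nb G S w : Set V)).Reachable x y

/-- Two neighbours of `u` in the neighbourhood of `w` would be adjacent, and with `u` and `w` would
form a four-clique. -/
theorem IsGood.isLeaf_of_isSimplicialIn (hG : IsGood G) {S : Finset V} {w u : V}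
    (hwu : G.Adj w u) (hu : IsSimplicialIn G S u) :
    IsLeaf (inside G (nb G S w : Set V)) u := by
  intro a b ha hb
  by_contra hab
  have ha' := mem_nb.1 (Finset.mem_coe.1 ha.2.2)
  have hb' := mem_nb.1 (Finset.mem_coe.1 hb.2.2)
  exact hG.not_clique hwu ha'.2 hb'.2 ha.1 hb.1 (hu a ha'.1 b hb'.1 ha.1 hb.1 hab)

theorem IsGood.linkConnected_core (hG : IsGood G) {S : Finset V} (hS : LinkConnected G S) :
    LinkConnected G (core G S) := by
  intro w hw x hx y hy
  have hsub := nb_mono (G := G) (core_subset (G := G) S) w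
  have hwS := core_subset S hw
  refine reachable_of_leaves hx hy (hS w hwS x (hsub hx) y (hsub hy)) fun z hz hz' => ?_
  have hz := mem_nb.1 (Finset.mem_coe.1 hz)
  refine hG.isLeaf_of_isSimplicialIn hz.2 ?_
  by_contra hcon
  exact hz' (Finset.mem_coe.2 (mem_nb.2 ⟨mem_core.2 ⟨hz.1, hcon⟩, hz.2⟩))

/-- A vertex that becomes simplicial only after peeling must have lost a neighbour. -/
theorem exists_simplicial_nb {S : Finset V} {u : V} (hu : u ∈ core G S)
    (hs : IsSimplicialIn G (core G S) u) : ∃ v ∈ S, G.Adj u v ∧ IsSimplicialIn G S v := by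
  by_contra! hcon
  refine (mem_core.1 hu).2 fun x hx y hy hux huy hxy => ?_
  exact hs x (mem_core.2 ⟨hx, hcon x hx hux⟩) y (mem_core.2 ⟨hy, hcon y hy huy⟩) hux huy hxy

variable [DecidableEq V]

/-- The neighbourhood of `w` is connected, and `not_book` bounds its degrees by two; the peeled
neighbours are leaves of it. -/
theorem IsGood.card_nb_sdiff_core (hG : IsGood G) {S : Finset V} (hS : LinkConnected G S) {w : V}
    (hw : w ∈ S) : (nb G S w \ nb G (core G S) w).card ≤ 2 := by
  by_contra! h
  obtain ⟨x, y, z, hx, hy, hz, hxy, hxz, hyz⟩ := Finset.two_lt_card_iff.1 h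
  have hleaf : ∀ v ∈ nb G S w \ nb G (core G S) w, IsLeaf (inside G (nb G S w : Set V)) v := by
    intro v hv
    rw [Finset.mem_sdiff, mem_nb, mem_nb, mem_core] at hv
    refine hG.isLeaf_of_isSimplicialIn hv.1.2 ?_
    by_contra hcon
    exact hv.2 ⟨⟨hv.1.1, hcon⟩, hv.1.2⟩
  have hmem : ∀ v ∈ nb G S w \ nb G (core G S) w, v ∈ nb G S w := fun v hv =>
    (Finset.mem_sdiff.1 hv).1
  refine not_three_leaves (H := inside G (nb G S w : Set V)) ?_
    (hS w hw x (hmem x hx) y (hmem y hy)) (hS w hw x (hmem x hx) z (hmem z hz)) (hleaf x hx)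
    (hleaf y hy) (hleaf z hz) hxy hxz hyz
  intro y a b c ha hb hc
  by_contra! hcon
  have hwy := (mem_nb.1 (Finset.mem_coe.1 ha.2.1)).2
  have hwa := (mem_nb.1 (Finset.mem_coe.1 ha.2.2)).2
  have hwb := (mem_nb.1 (Finset.mem_coe.1 hb.2.2)).2
  have hwc := (mem_nb.1 (Finset.mem_coe.1 hc.2.2)).2
  exact hG.not_book hwy hwa ha.1 hwb hb.1 hwc hc.1 hcon.1 hcon.2.1 hcon.2.2

theorem card_nb_eq {S : Finset V} (w : V) :
    (nb G S w).card = (nb G S w \ nb G (core G S) w).card + (nb G (core G S) w).card :=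
  (Finset.card_sdiff_add_card_eq_card (nb_mono (core_subset S) w)).symm

theorem exists_other_of_card_nb {T : Finset V} {v u : V} (hs : IsSimplicialIn G T v)
    (h : (nb G T v).card = 2) (huT : u ∈ T) (hvu : G.Adj v u) :
    ∃ t, nb G T v = {u, t} ∧ u ≠ t ∧ t ∈ T ∧ G.Adj v t ∧ G.Adj u t := by
  obtain ⟨a, b, hnb, hab, ha, hb, hva, hvb, hadj⟩ := exists_pair_of_card_nb hs h
  have hu : u ∈ nb G T v := mem_nb.2 ⟨huT, hvu⟩
  rw [hnb, Finset.mem_insert, Finset.mem_singleton] at hu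
  rcases hu with rfl | rfl
  · exact ⟨b, hnb, hab, hb, hvb, hadj⟩
  · exact ⟨a, hnb.trans (Finset.pair_comm _ _), hab.symm, ha, hva, hadj.symm⟩

/-- Each peeling costs a vertex at most two neighbours, so a simplicial vertex of the first core has
degree at most `4` in `T`, and one of the second core at most `6`. An ear on an edge joining two
such vertices is light since `4 + 6 ≤ n + 3`; this is where `7 ≤ n` is needed. -/
theorem IsGood.exists_light_ear (hG : IsGood G) {n : ℕ} (hn : 7 ≤ n) {T : Finset V}
    (hdeg : ∀ w, (nb G T w).card ≤ n) (hne : T.Nonempty) (hT : LinkConnected G T)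
    (hsim : ∀ v ∈ T, IsSimplicialIn G T v → (nb G T v).card = 2) :
    ∃ v u t, v ∈ T ∧ IsSimplicialIn G T v ∧ nb G T v = {u, t} ∧ u ≠ t ∧
      (nb G T u).card + (nb G T t).card ≤ n + 3 := by
  have hT' := hG.linkConnected_core hT
  have hfour : ∀ u ∈ core G T, IsSimplicialIn G (core G T) u → (nb G T u).card ≤ 4 := by
    intro u hu hus
    have h1 := hG.card_nb_le_two hus
    have h2 := hG.card_nb_sdiff_core hT (core_subset T hu)
    rw [card_nb_eq]
    omega
  rcases (core G T).eq_empty_or_nonempty with h0 | h0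
  · have hall : ∀ v ∈ T, IsSimplicialIn G T v := by
      intro v hv
      by_contra hcon
      have := mem_core.2 ⟨hv, hcon⟩
      simp [h0] at this
    obtain ⟨v, hv⟩ := hne
    obtain ⟨u, t, hnb, hut, hu, ht, -⟩ := exists_pair_of_card_nb (hall v hv) (hsim v hv (hall v hv))
    refine ⟨v, u, t, hv, hall v hv, hnb, hut, ?_⟩
    rw [hsim u hu (hall u hu), hsim t ht (hall t ht)]
    omega
  rcases (core G (core G T)).eq_empty_or_nonempty with h1 | h1
  · have hall : ∀ v ∈ core G T, IsSimplicialIn G (core G T) v := by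
      intro v hv
      by_contra hcon
      have := mem_core.2 ⟨hv, hcon⟩
      simp [h1] at this
    obtain ⟨u, hu⟩ := h0
    obtain ⟨v, hv, huv, hvs⟩ := exists_simplicial_nb hu (hall u hu)
    obtain ⟨t, hnb, hut, ht, -⟩ := exists_other_of_card_nb hvs (hsim v hv hvs)
      (core_subset T hu) huv.symm
    refine ⟨v, u, t, hv, hvs, hnb, hut, ?_⟩
    have h4 := hfour u hu (hall u hu)
    by_cases hts : IsSimplicialIn G T t
    · have := hsim t ht hts
      omega
    · have htc : t ∈ core G T := mem_core.2 ⟨ht, hts⟩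
      have := hfour t htc (hall t htc)
      omega
  -- `w` is simplicial in the second core, `u` is a neighbour of it peeled in the second round, and
  -- `v` an ear at `u`.
  obtain ⟨w, hw, hws⟩ := hG.chordal.exists_isSimplicialIn h1
  obtain ⟨u, hu, hwu, hus⟩ := exists_simplicial_nb hw hws
  obtain ⟨v, hv, huv, hvs⟩ := exists_simplicial_nb hu hus
  have hw' := core_subset _ hw
  have hwT := core_subset _ hw'
  have huT := core_subset _ hu
  have hw6 : (nb G T w).card ≤ 6 := by
    have a1 := hG.card_nb_le_two hws
    have a2 := hG.card_nb_sdiff_core hT' hw'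
    have a3 := hG.card_nb_sdiff_core hT hwT
    rw [card_nb_eq, card_nb_eq (S := core G T)]
    omega
  have hu4 := hfour u hu hus
  by_contra! hcon
  have hu4' : (nb G T u).card = 4 := by
    obtain ⟨t, hnb, hut, -⟩ := exists_other_of_card_nb hvs (hsim v hv hvs) huT huv.symm
    have a1 := hcon v u t hv hvs hnb hut
    have a2 := hdeg t
    omega
  have b1 := hG.card_nb_le_two hus
  have b2 := hG.card_nb_sdiff_core hT huT
  have b3 := card_nb_eq (G := G) (S := T) u
  obtain ⟨e, e', hee, hE⟩ := Finset.card_eq_two.1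
    (show (nb G T u \ nb G (core G T) u).card = 2 by omega)
  obtain ⟨x, hwx, hX⟩ : ∃ x, w ≠ x ∧ nb G (core G T) u = {w, x} := by
    obtain ⟨a, b, hab, hX⟩ := Finset.card_eq_two.1
      (show (nb G (core G T) u).card = 2 by omega)
    have hmem : w ∈ nb G (core G T) u := mem_nb.2 ⟨hw', hwu.symm⟩
    rw [hX, Finset.mem_insert, Finset.mem_singleton] at hmem
    rcases hmem with rfl | rfl
    · exact ⟨b, hab, hX⟩
    · exact ⟨a, hab.symm, hX.trans (Finset.pair_comm _ _)⟩
  have hx := mem_nb.1 (show x ∈ nb G (core G T) u by simp [hX])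
  have hwxadj := hus w hw' x hx.1 hwu.symm hx.2 hwx
  -- If all ears are heavy, neither ear at `u` can sit on `uw`, so both sit on `ux`. Together with
  -- `w` they are three common neighbours of `u` and `x`.
  have hear : ∀ e ∈ nb G T u \ nb G (core G T) u, G.Adj u e ∧ G.Adj x e ∧ w ≠ e := by
    intro e he
    rw [Finset.mem_sdiff, mem_nb, mem_nb, mem_core] at he
    have hes : IsSimplicialIn G T e := by
      by_contra h
      exact he.2 ⟨⟨he.1.1, h⟩, he.1.2⟩
    have hwe : w ≠ e := by
      rintro rfl
      exact (mem_core.1 hw').2 hes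
    obtain ⟨t, hnb, hut, ht, het, hadj⟩ :=
      exists_other_of_card_nb hes (hsim e he.1.1 hes) huT he.1.2.symm
    have hbig := hcon e u t he.1.1 hes hnb hut
    have htc : t ∈ core G T := by
      refine mem_core.2 ⟨ht, fun hts => ?_⟩
      have := hsim t ht hts
      omega
    have htX : t ∈ nb G (core G T) u := mem_nb.2 ⟨htc, hadj⟩
    rw [hX, Finset.mem_insert, Finset.mem_singleton] at htX
    rcases htX with rfl | rfl
    · omega
    · exact ⟨he.1.2, het.symm, hwe⟩
  have he := hear e (by simp [hE])
  have he' := hear e' (by simp [hE])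
  exact hG.not_book hx.2 hwu.symm hwxadj.symm he.1 he.2.1 he'.1 he'.2.1 he.2.2 he'.2.2 hee

theorem IsGood.exists_rainbow_of_seven_le (hG : IsGood G) {n : ℕ} (hn : 7 ≤ n)
    (hdeg : ∀ T w, (nb G T w).card ≤ n) (T : Finset V) :
    ∃ c : V → Fin (n + 1), Rainbow G T c := by
  refine hG.exists_rainbow hdeg (fun T hne hT hsim ih => ?_) T
  obtain ⟨v, u, t, hv, hs, hnb, hut, hsum⟩ := hG.exists_light_ear hn (hdeg T) hne
    (fun w hw x hx y hy => hG.reachable_nb hT hw hx hy) hsim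
  obtain ⟨c, hc⟩ := ih _ (Finset.erase_ssubset hv)
  exact hc.extend_ear hs hnb hut (hG.card_ear_le hT (hdeg T) hv hnb hut hsum)

theorem IsGood.exists_rainbow_of_rotation (hG : IsGood G) {n : ℕ} {pos : Rotation n}
    (hpos : pos.IsTriangulation) (hdeg : ∀ T w, (nb G T w).card ≤ n) (T : Finset V) :
    ∃ c : V → Fin (n + 1), Rainbow G T c := by
  refine hG.exists_rainbow hdeg (fun T _ hT _ _ => ?_) T
  obtain ⟨c, hc⟩ := hG.exists_develops hpos T
  exact ⟨c, hc.rainbow hpos hG hT (hdeg T)⟩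

end Ears

/-! ### Clique number and chromatic number of the square -/

section Square

variable {V : Type*} {G : SimpleGraph V}

theorem IsGood.exists_rainbow_of_not_F₄ [DecidableEq V] (hG : IsGood G) {n : ℕ}
    (hF : ¬ (n = 4 ∧ F₄.IsContained G)) (hdeg : ∀ T w, (nb G T w).card ≤ n) (T : Finset V) :
    ∃ c : V → Fin (n + 1), Rainbow G T c := by
  by_cases h3 : n ≤ 3
  · exact hG.exists_rainbow_of_two_mul_le le_rfl (by omega) hdeg T
  by_cases h4 : n = 4
  · subst h4
    exact hG.exists_rainbow_of_F₄_free (fun h => hF ⟨rfl, h⟩) hdeg T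
  by_cases h5 : n = 5
  · subst h5
    exact hG.exists_rainbow_of_rotation projectiveRotation_isTriangulation hdeg T
  by_cases h6 : n = 6
  · subst h6
    exact hG.exists_rainbow_of_rotation torusRotation_isTriangulation hdeg T
  exact hG.exists_rainbow_of_seven_le (by omega) hdeg T

/-- Any two ears share a triangle vertex, and an ear reaches the vertex it misses through either of
the others. Adjacency is first put in Boolean form so that `decide` can evaluate it. -/
theorem square_F₄_adj : ∀ x y : Fin 3 ⊕ Fin 3, x ≠ y →
    F₄.Adj x y ∨ ∃ z, F₄.Adj x z ∧ F₄.Adj y z := by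
  have key : ∀ x y : Fin 3 ⊕ Fin 3, F₄.Adj x y ↔ x.elim
      (fun i => y.elim (fun j => decide (i ≠ j)) (fun j => decide (i ≠ j)))
      (fun i => y.elim (fun j => decide (i ≠ j)) (fun _ => false)) = true := by
    rintro (i | i) (j | j) <;> simp only [F₄, SimpleGraph.fromRel_adj] <;> simp
    · exact fun h => Or.inl h
    · rw [eq_comm]
  simp only [key]
  decide

theorem exists_isClique_square_of_F₄ (h : F₄.IsContained G) :
    ∃ s : Finset V, (square G).IsClique s ∧ s.card = 6 := by
  obtain ⟨f⟩ := h
  refine ⟨Finset.univ.map ⟨f, f.injective⟩, ?_, by simp⟩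
  intro x hx y hy hxy
  rw [Finset.mem_coe, Finset.mem_map] at hx hy
  obtain ⟨i, -, rfl⟩ := hx
  obtain ⟨j, -, rfl⟩ := hy
  refine ⟨hxy, ?_⟩
  rcases square_F₄_adj i j (fun h => hxy (by rw [h])) with h | ⟨z, hi, hj⟩
  · exact Or.inl (f.toHom.map_adj h)
  · exact Or.inr ⟨f z, f.toHom.map_adj hi, f.toHom.map_adj hj⟩

variable [Fintype V]

theorem colorable_square {n : ℕ} {c : V → Fin n} (hc : Rainbow G Finset.univ c) :
    (square G).Colorable n := by
  refine ⟨SimpleGraph.Coloring.mk c ?_⟩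
  rintro u v ⟨hne, h | ⟨w, hu, hv⟩⟩
  · exact hc u (Finset.mem_univ _) u (Finset.mem_univ _) v (Finset.mem_univ _) hne (Or.inl rfl)
      (Or.inr h)
  · exact hc w (Finset.mem_univ _) u (Finset.mem_univ _) v (Finset.mem_univ _) hne
      (Or.inr hu.symm) (Or.inr hv.symm)

/-- A clique and a colouring of the same size pin both invariants between them. -/
theorem cliqueNum_eq_and_chromaticNumber_eq {H : SimpleGraph V} {n : ℕ} {s : Finset V}
    (hs : H.IsClique s) (hcard : n ≤ s.card) (hcol : H.Colorable n) :
    H.cliqueNum = n ∧ H.chromaticNumber = (n : ℕ∞) := by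
  have h1 : n ≤ H.cliqueNum := hcard.trans hs.card_le_cliqueNum
  have h2 : (H.cliqueNum : ℕ∞) ≤ H.chromaticNumber := SimpleGraph.cliqueNum_le_chromaticNumber
  have h3 : H.chromaticNumber ≤ n := SimpleGraph.chromaticNumber_le_iff_colorable.2 hcol
  have h4 : H.cliqueNum ≤ n := by exact_mod_cast h2.trans h3
  refine ⟨le_antisymm h4 h1, le_antisymm h3 ?_⟩
  exact le_trans (by exact_mod_cast h1) h2

theorem isClique_square_closedNeighborhood [DecidableEq V] [DecidableRel G.Adj] (v : V) :
    (square G).IsClique (insert v (G.neighborFinset v) : Finset V) := by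
  intro x hx y hy hxy
  simp only [Finset.coe_insert, Set.mem_insert_iff, Finset.mem_coe,
    SimpleGraph.mem_neighborFinset] at hx hy
  rcases hx with rfl | hx <;> rcases hy with rfl | hy
  · exact absurd rfl hxy
  · exact ⟨hxy, Or.inl hy⟩
  · exact ⟨hxy, Or.inl hx.symm⟩
  · exact ⟨hxy, Or.inr ⟨v, hx.symm, hy.symm⟩⟩

theorem card_nb_le_maxDegree [DecidableRel G.Adj] (T : Finset V) (w : V) :
    (nb G T w).card ≤ G.maxDegree := by
  refine le_trans (Finset.card_le_card fun x hx => ?_) (G.degree_le_maxDegree w)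
  exact (SimpleGraph.mem_neighborFinset _ _ _).2 (mem_nb.1 hx).2

end Square

end ChordalOuterplanar

theorem mainTheorem4 {V : Type*} [Fintype V] [Nonempty V] (G : SimpleGraph V)
    [DecidableRel G.Adj] (hchordal : ChordalOuterplanar.IsChordal G)
    (houter : ChordalOuterplanar.IsOuterplanar G) :
    (G.maxDegree = 4 ∧ ChordalOuterplanar.F₄.IsContained G →
      (ChordalOuterplanar.square G).cliqueNum = G.maxDegree + 2 ∧
      (ChordalOuterplanar.square G).chromaticNumber = ((G.maxDegree + 2 : ℕ) : ℕ∞)) ∧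
    (¬ (G.maxDegree = 4 ∧ ChordalOuterplanar.F₄.IsContained G) →
      (ChordalOuterplanar.square G).cliqueNum = G.maxDegree + 1 ∧
      (ChordalOuterplanar.square G).chromaticNumber = ((G.maxDegree + 1 : ℕ) : ℕ∞)) := by
  classical
  have hG := houter.isGood hchordal
  constructor
  · rintro ⟨h4, hF⟩
    obtain ⟨s, hs, hcard⟩ := ChordalOuterplanar.exists_isClique_square_of_F₄ hF
    -- With `Δ = 4` and six colours the condition reads `2 * 4 ≤ 5 + 3`.
    obtain ⟨c, hc⟩ := hG.exists_rainbow_of_two_mul_le (m := G.maxDegree) (n := G.maxDegree + 1)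
      (by omega) (by omega) ChordalOuterplanar.card_nb_le_maxDegree Finset.univ
    exact ChordalOuterplanar.cliqueNum_eq_and_chromaticNumber_eq hs (by omega)
      (ChordalOuterplanar.colorable_square hc)
  · intro hF
    obtain ⟨v, hv⟩ := G.exists_maximal_degree_vertex
    obtain ⟨c, hc⟩ := hG.exists_rainbow_of_not_F₄ hF ChordalOuterplanar.card_nb_le_maxDegree
      Finset.univ
    refine ChordalOuterplanar.cliqueNum_eq_and_chromaticNumber_eq
      (ChordalOuterplanar.isClique_square_closedNeighborhood v) ?_
      (ChordalOuterplanar.colorable_square hc)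
    rw [Finset.card_insert_of_notMem (by simp), SimpleGraph.card_neighborFinset_eq_degree, hv]
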